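/- Let $k$ be a field, $S=k[x_1,\dots,x_n]$ with the standard grading, and let $\Delta$ be a simplicial complex on vertices from $\{x_1,\dots,x_n\}$. Its facets are its maximal faces, and its facet ideal is $I=\big(\prod_{x_i\in F}x_i : F \text{ a facet of } \Delta\big)\subseteq S$. A facet $F$ of a complex is a leaf if it is the only facet, or if there is a facet $G\ne F$ such that $F\cap H\subseteq G$ for all facets $H\neq F$. A subcollection of $\Delta$ is a simplicial complex all of whose facets are facets of $\Delta$, and $\Delta$ is a simplicial forest if every nonempty subcollection of $\Delta$ has a leaf. Let $$\cdots\to\bigoplus_{j\in\mathbb N}S(-j)^{\beta_{2,j}}\to\bigoplus_{j\in\mathbb N}S(-j)^{\beta_{1,j}}\to\bigoplus_{j\in\mathbb N}S(-j)^{\beta_{0,j}}\to S/I\to 0$$ be a minimal graded free resolution of $S/I$, with graded Betti numbers $\beta_{i,j}=\beta_{i,j}(S/I)$, and put $t_i(I)=\max\{j : \beta_{i,j}(S/I)\neq 0\}$. Theorem (subadditivity of Betti numbers of forests). Let $\Delta$ be a simplicial forest with facet ideal $I$, and let $a,b>0$ be integers with $a+b$ at most the projective dimension of $S/I$. Then the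 maxima $t_a(I)$, $t_b(I)$ and $t_{a+b}(I)$ exist and $$t_{a+b}(I)\le t_a(I)+t_b(I).$$ -/

import Mathlib

namespace PreAbstractSimplicialComplex

variable {σ : Type*}

/-- The facets of a simplicial complex: its faces that are maximal under inclusion. -/
def facets (Δ : PreAbstractSimplicialComplex σ) : Set (Finset σ) :=
  {F | Maximal (fun G => G ∈ Δ) F}

/-- A facet `F` of `Δ` is a leaf if it is the only facet of `Δ`, or if some other facet `G`
contains the intersection of `F` with every facet different from `F`. -/
def IsLeaf [DecidableEq σ] (Δ : PreAbstractSimplicialComplex σ) (F : Finset σ) : Prop :=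
  F ∈ Δ.facets ∧
    (Δ.facets = {F} ∨
      ∃ G ∈ Δ.facets, G ≠ F ∧ ∀ H ∈ Δ.facets, H ≠ F → F ∩ H ⊆ G)

/-- `Γ` is a subcollection of `Δ` if every facet of `Γ` is a facet of `Δ`. -/
def IsSubcollection (Γ Δ : PreAbstractSimplicialComplex σ) : Prop :=
  Γ.facets ⊆ Δ.facets

/-- A simplicial forest: every nonempty subcollection has a leaf. -/
def IsForest [DecidableEq σ] (Δ : PreAbstractSimplicialComplex σ) : Prop :=
  ∀ Γ : PreAbstractSimplicialComplex σ, Γ.IsSubcollection Δ → Γ.facets.Nonempty →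
    ∃ F, Γ.IsLeaf F

/-- The facet ideal of `Δ`, generated by the square-free monomials `∏ i ∈ F, x_i` for the
facets `F` of `Δ`. -/
noncomputable def facetIdeal (k : Type*) [Field k] (Δ : PreAbstractSimplicialComplex σ) :
    Ideal (MvPolynomial σ k) :=
  Ideal.span ((fun F : Finset σ => ∏ i ∈ F, MvPolynomial.X i) '' Δ.facets)

end PreAbstractSimplicialComplex

/-- A minimal graded free resolution
`⋯ → F₂ → F₁ → F₀ → S/I → 0` of `S/I`, where `S = k[x_i : i ∈ σ]` is standard graded.
Here `F_i = ⊕_e S(-shift i e)`, the sum being over the standard basis `e` of the free module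
`F_i = S ^ rank i`, and every map preserves degrees. -/
structure MinimalGradedFreeResolution {σ k : Type*} [Field k]
    (I : Ideal (MvPolynomial σ k)) where
  /-- The rank of `F_i`. -/
  rank : ℕ → ℕ
  /-- The degrees of the basis elements of `F_i`. -/
  shift : (i : ℕ) → Fin (rank i) → ℕ
  /-- The differential `F_{i+1} → F_i`. -/
  d : (i : ℕ) → (Fin (rank (i + 1)) → MvPolynomial σ k) →ₗ[MvPolynomial σ k]
    (Fin (rank i) → MvPolynomial σ k)
  /-- The augmentation `F₀ → S/I`. -/
  aug : (Fin (rank 0) → MvPolynomial σ k) →ₗ[MvPolynomial σ k] (MvPolynomial σ k ⧸ I)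
  aug_surjective : Function.Surjective aug
  exact_zero : Function.Exact (d 0) aug
  exact_succ : ∀ i, Function.Exact (d (i + 1)) (d i)
  /-- The augmentation sends a basis element of degree `j` to the class of a form of degree `j`. -/
  aug_graded : ∀ e, ∃ f : MvPolynomial σ k, f.IsHomogeneous (shift 0 e) ∧
    aug (Pi.single e 1) = Ideal.Quotient.mk I f
  /-- The `(e', e)` entry of the matrix of the differential is zero or homogeneous of degree
  `shift (i + 1) e - shift i e'` (which is then nonnegative). -/
  d_graded : ∀ i e e', d i (Pi.single e 1) e' = 0 ∨
    ∃ m, shift i e' + m = shift (i + 1) e ∧ (d i (Pi.single e 1) e').IsHomogeneous m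
  /-- Minimality: the image of `F_{i+1}` lies in `𝔪 F_i`, where `𝔪` is generated by the
  variables. -/
  minimal : ∀ i, LinearMap.range (d i) ≤
    MvPolynomial.idealOfVars σ k • (⊤ : Submodule (MvPolynomial σ k) _)

/-- The graded Betti number `β_{i,j}`: the number of summands `S(-j)` of `F_i`. -/
def MinimalGradedFreeResolution.betti {σ k : Type*} [Field k] {I : Ideal (MvPolynomial σ k)}
    (R : MinimalGradedFreeResolution I) (i j : ℕ) : ℕ :=
  (Finset.univ.filter fun e : Fin (R.rank i) => R.shift i e = j).card

/-! Tensored with the field, the Taylor complex of the facets computes the graded pieces of Tor, so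
`betti i j` is nonzero exactly when this reduced complex has homology in degree `i` and some
squarefree multidegree `m` with `j` elements (`betti_ne_zero_iff_taylorHomologyNonzero`). Its
boundary keeps only the incidences that do not change the union of the facets of a face, so it
splits by multidegree. It then suffices to cover a multidegree `m` supporting homology in degree `a
+ b` by multidegrees `m₁`, `m₂` supporting homology in degrees `a` and `b`: the size of a union is
at most the sum of the sizes (`IsForestFamily.exists_taylorHomologyNonzero`).

The covering is built by induction on the number of sets. An empty set kills all homology, and a set
containing another one is redundant. Otherwise a leaf `f l` has a vertex `v` in no other set. If `v`
is not in `m`, the leaf can be dropped. If `v` is in `m`, every face of multidegree `m` contains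
`l`, and taking links identifies the homology with that of the family `f i \ f l`, one degree lower
(`taylorHomologyNonzero_succ_iff_of_mem`); this family is again a forest. Of the two multidegrees
found there, one is lifted by adding `f l`, which raises its degree by one. The other keeps its
degree, since setting the variables of `f l` to 1 creates no homology
(`TaylorHomologyNonzero.exists_of_sdiff`). -/

open Finset

/-! ### Weighted boundary of a simplex -/

section SimplexBoundary

variable {ι R : Type*} [LinearOrder ι] [CommRing R]

/-- The sign with which the face `B` occurs in the boundary of `insert i B`. -/
def faceSign (R : Type*) [CommRing R] (i : ι) (B : Finset ι) : R :=
  (-1) ^ #{j ∈ B | j < i}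

lemma faceSign_mul_self (i : ι) (B : Finset ι) : faceSign R i B * faceSign R i B = 1 := by
  rw [faceSign, ← mul_pow]; simp

lemma faceSign_insert {i j : ι} {B : Finset ι} (hj : j ∉ B) :
    faceSign R i (insert j B) = (if j < i then -1 else 1) * faceSign R i B := by
  unfold faceSign
  rw [filter_insert]
  split_ifs with h
  · rw [card_insert_of_notMem (by simp [hj]), pow_succ']
  · simp

lemma faceSign_mul_comm {i j : ι} (hij : i ≠ j) {B : Finset ι} (hi : i ∉ B) (hj : j ∉ B) :
    faceSign R j B * faceSign R i (insert j B) = -(faceSign R i B * faceSign R j (insert i B)) := by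
  rw [faceSign_insert hi, faceSign_insert hj]
  rcases lt_or_gt_of_ne hij with h | h
  · rw [if_neg h.not_gt, if_pos h]; ring
  · rw [if_pos h, if_neg h.not_gt]; ring

/-- The boundary map of the full simplex on `ι`, the face `B` of `insert i B` being weighted by
`w B i`. A chain is a function on finite subsets of `ι`. -/
def weightedBoundary [Fintype ι] (w : Finset ι → ι → R) : (Finset ι → R) →ₗ[R] (Finset ι → R) where
  toFun c B := ∑ i ∈ Bᶜ, faceSign R i B * w B i * c (insert i B)
  map_add' c c' := by
    ext B; simp [mul_add, sum_add_distrib]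
  map_smul' r c := by
    ext B; simp only [Pi.smul_apply, smul_eq_mul, RingHom.id_apply, mul_sum]
    exact sum_congr rfl fun i _ => by ring

lemma weightedBoundary_apply [Fintype ι] (w : Finset ι → ι → R) (c : Finset ι → R)
    (B : Finset ι) :
    weightedBoundary w c B = ∑ i ∈ Bᶜ, faceSign R i B * w B i * c (insert i B) := rfl

/-- The two orders of deleting `i` and `j` carry equal weights by `hw` and opposite signs, so
swapping the pair is a cancelling involution. -/
lemma weightedBoundary_weightedBoundary [Fintype ι] {w : Finset ι → ι → R}
    (hw : ∀ B i j, w B i * w (insert i B) j = w B j * w (insert j B) i) (c : Finset ι → R) :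
    weightedBoundary w (weightedBoundary w c) = 0 := by
  ext B
  simp only [weightedBoundary_apply, mul_sum, Pi.zero_apply]
  rw [sum_sigma']
  refine sum_involution (fun x _ => ⟨x.2, x.1⟩) ?_ ?_ ?_ ?_
  · rintro ⟨i, j⟩ h
    simp only [mem_sigma, mem_compl, mem_insert, not_or] at h
    obtain ⟨hi, hji, hj⟩ := h
    have h1 := faceSign_mul_comm (R := R) (Ne.symm hji) hi hj
    have h2 := hw B i j
    dsimp only
    rw [insert_comm j i]
    linear_combination (faceSign R j (insert i B) * faceSign R i B * c (insert i (insert j B))) * h2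
      + (w B j * w (insert j B) i * c (insert i (insert j B))) * h1
  · rintro ⟨i, j⟩ h _ h'
    simp only [mem_sigma, mem_compl, mem_insert, not_or] at h
    simp only [Sigma.mk.injEq, heq_eq_eq] at h'
    exact h.2.1 h'.1
  · rintro ⟨i, j⟩ h
    simp only [mem_sigma, mem_compl, mem_insert, not_or] at h ⊢
    exact ⟨h.2.2, Ne.symm h.2.1, h.1⟩
  · rintro ⟨i, j⟩ h; rfl

end SimplexBoundary

lemma biUnion_insert_of_subset {ι σ : Type*} [DecidableEq ι] [DecidableEq σ] {f : ι → Finset σ}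
    {B : Finset ι} {i : ι} (h : f i ⊆ B.biUnion f) :
    (insert i B).biUnion f = B.biUnion f := by
  rw [biUnion_insert, union_eq_right.2 h]

lemma biUnion_sdiff_const {ι σ : Type*} [DecidableEq σ] (f : ι → Finset σ) (W : Finset σ)
    (A : Finset ι) :
    (A.biUnion fun i => f i \ W) = A.biUnion f \ W := by
  ext x; simp only [mem_biUnion, mem_sdiff]; tauto

/-! ### The Taylor complex modulo the variables -/

section ReducedTaylor

variable {ι σ k : Type*} [LinearOrder ι] [Fintype ι] [DecidableEq σ] [CommRing k]

/-- The weights of the Taylor complex modulo the variables. -/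
def reducedWeight (k : Type*) [CommRing k] (f : ι → Finset σ) (B : Finset ι) (i : ι) : k :=
  if f i ⊆ B.biUnion f then 1 else 0

/-- The differential of the Taylor complex of the monomials `∏ x ∈ f i, x` modulo the variables. -/
def reducedBoundary (k : Type*) [CommRing k] (f : ι → Finset σ) :
    (Finset ι → k) →ₗ[k] (Finset ι → k) :=
  weightedBoundary (reducedWeight k f)

variable {f : ι → Finset σ}

lemma reducedBoundary_apply (c : Finset ι → k) (B : Finset ι) :
    reducedBoundary k f c B =
      ∑ i ∈ Bᶜ, faceSign k i B * (if f i ⊆ B.biUnion f then 1 else 0) * c (insert i B) := rfl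

/-- In either order the product of weights is 1 exactly when both `f i` and `f j` lie in the union
over `B`. -/
lemma reducedBoundary_reducedBoundary (c : Finset ι → k) :
    reducedBoundary k f (reducedBoundary k f c) = 0 := by
  refine weightedBoundary_weightedBoundary (fun B i j => ?_) c
  have key : ∀ i j : ι, (f i ⊆ B.biUnion f ∧ f j ⊆ f i ∪ B.biUnion f) ↔
      (f i ⊆ B.biUnion f ∧ f j ⊆ B.biUnion f) := fun i j => by
    constructor
    · rintro ⟨h1, h2⟩; exact ⟨h1, by rwa [union_eq_right.2 h1] at h2⟩
    · rintro ⟨h1, h2⟩; exact ⟨h1, h2.trans subset_union_right⟩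
  simp only [reducedWeight, biUnion_insert, mul_ite, mul_one, mul_zero, ← ite_and]
  refine if_congr ?_ rfl rfl
  rw [and_comm, key i j, and_comm (a := f i ⊆ f j ∪ _), key j i, and_comm]

lemma reducedBoundary_congr {f g : ι → Finset σ} {c c' : Finset ι → k} {B : Finset ι}
    (h : ∀ i ∉ B, (if f i ⊆ B.biUnion f then c (insert i B) else 0) =
      if g i ⊆ B.biUnion g then c' (insert i B) else 0) :
    reducedBoundary k f c B = reducedBoundary k g c' B := by
  rw [reducedBoundary_apply, reducedBoundary_apply]
  refine sum_congr rfl fun i hi => ?_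
  have := h i (by simpa using hi)
  simp only [mul_assoc, ite_mul, one_mul, zero_mul, this]

lemma reducedBoundary_eq_zero {c : Finset ι → k} {B : Finset ι}
    (h : ∀ i ∉ B, f i ⊆ B.biUnion f → c (insert i B) = 0) : reducedBoundary k f c B = 0 := by
  rw [reducedBoundary_congr (g := f) (c' := 0), map_zero, Pi.zero_apply]
  intro i hi
  split_ifs with h1
  · rw [h i hi h1]; rfl
  · rfl

lemma exists_of_reducedBoundary_ne_zero {c : Finset ι → k} {B : Finset ι}
    (h : reducedBoundary k f c B ≠ 0) :
    ∃ i ∉ B, f i ⊆ B.biUnion f ∧ c (insert i B) ≠ 0 := by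
  by_contra! h'
  exact h (reducedBoundary_eq_zero h')

open Classical in
-- Incidences of nonzero weight preserve the union of a face and change its size by one; this lemma
-- therefore allows chains to be cut down to one multidegree or one size.
lemma reducedBoundary_indicator (c : Finset ι → k) (Q Q' : Set (Finset ι))
    (h : ∀ B, ∀ i ∉ B, f i ⊆ B.biUnion f → (insert i B ∈ Q ↔ B ∈ Q')) :
    reducedBoundary k f (Q.indicator c) = Q'.indicator (reducedBoundary k f c) := by
  ext B
  by_cases hB : B ∈ Q'
  · rw [Set.indicator_of_mem hB]
    refine reducedBoundary_congr fun i hi => ?_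
    split_ifs with h1
    · rw [Set.indicator_of_mem ((h B i hi h1).2 hB)]
    · rfl
  · rw [Set.indicator_of_notMem hB]
    refine reducedBoundary_eq_zero fun i hi h1 => ?_
    rw [Set.indicator_of_notMem (mt (h B i hi h1).1 hB)]

/-- The part of the `p`-th homology of the reduced Taylor complex on `(f i)_{i ∈ s}` that lives in
the squarefree multidegree `m` does not vanish. -/
def TaylorHomologyNonzero (k : Type*) [CommRing k] (s : Finset ι) (f : ι → Finset σ) (p : ℕ)
    (m : Finset σ) : Prop :=
  ∃ c : Finset ι → k, (∀ A, c A ≠ 0 → A ⊆ s ∧ #A = p ∧ A.biUnion f = m) ∧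
    reducedBoundary k f c = 0 ∧
    ¬ ∃ b : Finset ι → k, (∀ A, b A ≠ 0 → A ⊆ s) ∧ reducedBoundary k f b = c

lemma TaylorHomologyNonzero.exists_biUnion_eq {s : Finset ι} {p : ℕ} {m : Finset σ}
    (h : TaylorHomologyNonzero k s f p m) : ∃ A ⊆ s, #A = p ∧ A.biUnion f = m := by
  obtain ⟨c, hc, -, h3⟩ := h
  by_contra! h'
  refine h3 ⟨0, by simp, ?_⟩
  rw [map_zero]
  ext A
  by_contra hA
  obtain ⟨h1, h2, h4⟩ := hc A (Ne.symm hA)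
  exact h' A h1 h2 h4

/-- A cycle all of whose multidegrees have vanishing homology is a boundary. -/
lemma exists_reducedBoundary_eq_of_forall_not {s : Finset ι} {p : ℕ} (Q : Set (Finset σ))
    (hQ : ∀ m ∈ Q, ¬ TaylorHomologyNonzero k s f p m) {c : Finset ι → k}
    (hc : ∀ A, c A ≠ 0 → A ⊆ s ∧ #A = p ∧ A.biUnion f ∈ Q) (hc0 : reducedBoundary k f c = 0) :
    ∃ b : Finset ι → k, (∀ A, b A ≠ 0 → A ⊆ s ∧ #A = p + 1 ∧ A.biUnion f ∈ Q) ∧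
      reducedBoundary k f b = c := by
  classical
  have hex : ∀ m, ∃ b : Finset ι → k, (∀ A, b A ≠ 0 → A ⊆ s) ∧
      (m ∈ Q → reducedBoundary k f b = Set.indicator {A | A.biUnion f = m} c) := fun m => by
    by_cases hm : m ∈ Q
    · have h1 := hQ m hm
      simp only [TaylorHomologyNonzero, not_exists, not_and, not_forall] at h1
      have h2 := h1 (Set.indicator {A | A.biUnion f = m} c) (fun A hA => by
        have hA' : A ∈ {A : Finset ι | A.biUnion f = m} := Set.mem_of_indicator_ne_zero hA
        rw [Set.indicator_of_mem hA'] at hA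
        exact ⟨(hc A hA).1, (hc A hA).2.1, hA'⟩) (by
        rw [reducedBoundary_indicator c _ {A | A.biUnion f = m}, hc0]
        · simp
        · intro B i _ h
          simp only [Set.mem_ofPred_eq, biUnion_insert_of_subset h])
      push Not at h2
      obtain ⟨b, hb, hb'⟩ := h2
      exact ⟨b, hb, fun _ => hb'⟩
    · exact ⟨0, by simp, fun h => absurd h hm⟩
  choose bm hbm hbm' using hex
  -- The bounding chains of the separate multidegrees are glued: the value at `A` is read from the
  -- one belonging to the union over `A`.
  refine ⟨Set.indicator {A | #A = p + 1 ∧ A.biUnion f ∈ Q} fun A => bm (A.biUnion f) A, ?_, ?_⟩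
  · intro A hA
    have hA' : A ∈ {A | #A = p + 1 ∧ A.biUnion f ∈ Q} := Set.mem_of_indicator_ne_zero hA
    rw [Set.indicator_of_mem hA'] at hA
    exact ⟨hbm _ A hA, hA'⟩
  · rw [reducedBoundary_indicator _ _ {A | #A = p ∧ A.biUnion f ∈ Q}]
    · ext B
      by_cases hB : B ∈ {A : Finset ι | #A = p ∧ A.biUnion f ∈ Q}
      · rw [Set.indicator_of_mem hB, reducedBoundary_congr (g := f) (c' := bm (B.biUnion f)),
          hbm' _ hB.2, Set.indicator_of_mem (by simp)]
        intro i _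
        split_ifs with h1
        · rw [biUnion_insert_of_subset h1]
        · rfl
      · rw [Set.indicator_of_notMem hB]
        by_contra h
        exact hB (hc B (Ne.symm h)).2
    · intro B i hi h
      simp [biUnion_insert_of_subset h, card_insert_of_notMem hi]

/-- Deleting `W` creates new incidences only where adding `i` strictly enlarges the union of the
original sets; `hc` excludes chain coefficients there. -/
lemma reducedBoundary_sdiff_eq {W : Finset σ} {c : Finset ι → k} {B : Finset ι}
    (hc : ∀ A, c A ≠ 0 → #(A.biUnion f) ≤ #(B.biUnion f)) :
    reducedBoundary k (fun i => f i \ W) c B = reducedBoundary k f c B := by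
  refine reducedBoundary_congr fun i hi => ?_
  rw [biUnion_sdiff_const]
  by_cases h1 : f i ⊆ B.biUnion f
  · rw [if_pos h1, if_pos (sdiff_subset_sdiff h1 subset_rfl)]
  · rw [if_neg h1]
    split_ifs with h2
    · by_contra h3
      refine (hc _ h3).not_gt (card_lt_card ?_)
      rw [biUnion_insert]
      exact ⟨subset_union_right, fun h => h1 (subset_union_left.trans h)⟩
    · rfl

/-- Setting variables to `1` does not create homology. -/
lemma TaylorHomologyNonzero.exists_of_sdiff {s : Finset ι} {p : ℕ} {m W : Finset σ}
    (h : TaylorHomologyNonzero k s (fun i => f i \ W) p m) :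
    ∃ m', m' \ W = m ∧ TaylorHomologyNonzero k s f p m' := by
  classical
  by_contra! hno
  obtain ⟨c, hc, hc0, hcb⟩ := h
  refine hcb ?_
  -- Induction on a bound for the sizes of the multidegrees of the cycle with respect to `f`.
  have key : ∀ N : ℕ, ∀ c : Finset ι → k,
      (∀ A, c A ≠ 0 → A ⊆ s ∧ #A = p ∧ A.biUnion f \ W = m ∧ #(A.biUnion f) < N) →
      reducedBoundary k (fun i => f i \ W) c = 0 →
      ∃ b : Finset ι → k, (∀ A, b A ≠ 0 → A ⊆ s) ∧
        reducedBoundary k (fun i => f i \ W) b = c := by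
    intro N
    induction N with
    | zero =>
      intro c hc _
      refine ⟨0, by simp, ?_⟩
      rw [map_zero]
      ext A
      by_contra hA
      exact absurd (hc A (Ne.symm hA)).2.2.2 (by simp)
    | succ N ih =>
      intro c hc hc0
      -- The sizes of the original unions filter the complex. The extra incidences of `f i \ W`
      -- raise this size, so the top part of the cycle is already a cycle for `f`.
      let top : Set (Finset ι) := {A | #(A.biUnion f) = N}
      have htop : reducedBoundary k f (top.indicator c) = 0 := by
        rw [reducedBoundary_indicator c top top]
        · ext B
          by_cases hB : B ∈ top
          · rw [Set.indicator_of_mem hB, ← reducedBoundary_sdiff_eq (W := W), hc0]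
            intro A hA
            have h1 := (hc A hA).2.2.2
            have h2 : #(B.biUnion f) = N := hB
            omega
          · rw [Set.indicator_of_notMem hB]; rfl
        · intro B i _ h
          simp only [top, Set.mem_ofPred_eq, biUnion_insert_of_subset h]
      obtain ⟨b, hb, hbc⟩ := exists_reducedBoundary_eq_of_forall_not (s := s) (p := p)
        {m' | m' \ W = m ∧ #m' = N} (fun m' hm' => hno m' hm'.1)
        (fun A hA => by
          have hA' : A ∈ top := Set.mem_of_indicator_ne_zero hA
          rw [Set.indicator_of_mem hA'] at hA
          obtain ⟨h1, h2, h3, -⟩ := hc A hA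
          exact ⟨h1, h2, h3, hA'⟩) htop
      have hbtop : ∀ A ∈ top, reducedBoundary k (fun i => f i \ W) b A = c A := fun A hA => by
        rw [reducedBoundary_sdiff_eq, hbc, Set.indicator_of_mem hA]
        intro B hB
        exact ((hb B hB).2.2.2.trans (Eq.symm hA)).le
      -- Subtracting the boundary of `b` removes the top part, and the new terms it introduces have
      -- smaller unions.
      have hsupp : ∀ A, (c - reducedBoundary k (fun i => f i \ W) b) A ≠ 0 →
          A ⊆ s ∧ #A = p ∧ A.biUnion f \ W = m ∧ #(A.biUnion f) < N := by
        intro A hA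
        have hAtop : #(A.biUnion f) ≠ N := fun h => hA (by
          rw [Pi.sub_apply, hbtop A h, sub_self])
        by_cases h0 : reducedBoundary k (fun i => f i \ W) b A = 0
        · obtain ⟨h1, h2, h3, h4⟩ := hc A (by simpa [h0] using hA)
          exact ⟨h1, h2, h3, by omega⟩
        · obtain ⟨i, hi, hiA, hbi⟩ := exists_of_reducedBoundary_ne_zero h0
          obtain ⟨h1, h2, h3, h4⟩ := hb _ hbi
          rw [biUnion_sdiff_const] at hiA
          rw [card_insert_of_notMem hi] at h2
          rw [biUnion_insert] at h3 h4
          have h5 := card_le_card (subset_union_right (s₁ := f i) (s₂ := A.biUnion f))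
          refine ⟨(subset_insert _ _).trans h1, by omega, ?_, by omega⟩
          rw [← h3, union_sdiff_distrib, union_eq_right.2 hiA]
      obtain ⟨b', hb', hb'c⟩ := ih (c - reducedBoundary k (fun i => f i \ W) b) hsupp
        (by rw [map_sub, hc0, reducedBoundary_reducedBoundary, sub_zero])
      refine ⟨b + b', fun A hA => ?_, by rw [map_add, hb'c]; abel⟩
      by_cases h : b A = 0
      · exact hb' A (by simpa [h] using hA)
      · exact (hb A h).1
  refine key (#(univ.biUnion f) + 1) c (fun A hA => ?_) hc0
  obtain ⟨h1, h2, h3⟩ := hc A hA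
  refine ⟨h1, h2, by rw [← biUnion_sdiff_const]; exact h3, Nat.lt_succ_iff.2 ?_⟩
  exact card_le_card (biUnion_subset_biUnion_of_subset_left f (subset_univ A))

end ReducedTaylor

/-! ### Links, cones and the removal of one set -/

section ReducedTaylor

variable {ι σ k : Type*} [LinearOrder ι] [DecidableEq σ] [CommRing k]

/-- The chains on faces containing `a`, with `a` removed from the faces. -/
def linkMap (k : Type*) [CommRing k] (a : ι) : (Finset ι → k) →ₗ[k] (Finset ι → k) where
  toFun c A := if a ∈ A then 0 else faceSign k a A * c (insert a A)
  map_add' c c' := by ext A; by_cases h : a ∈ A <;> simp [h, mul_add]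
  map_smul' r c := by ext A; by_cases h : a ∈ A <;> simp [h, mul_left_comm]

/-- The cone with apex `a` over a chain. -/
def coneMap (k : Type*) [CommRing k] (a : ι) : (Finset ι → k) →ₗ[k] (Finset ι → k) where
  toFun c A := if a ∈ A then faceSign k a (A.erase a) * c (A.erase a) else 0
  map_add' c c' := by ext A; by_cases h : a ∈ A <;> simp [h, mul_add]
  map_smul' r c := by ext A; by_cases h : a ∈ A <;> simp [h, mul_left_comm]

lemma linkMap_of_mem {a : ι} {A : Finset ι} (h : a ∈ A) (c : Finset ι → k) :
    linkMap k a c A = 0 := if_pos h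

lemma linkMap_of_notMem {a : ι} {A : Finset ι} (h : a ∉ A) (c : Finset ι → k) :
    linkMap k a c A = faceSign k a A * c (insert a A) := if_neg h

lemma coneMap_of_mem {a : ι} {A : Finset ι} (h : a ∈ A) (c : Finset ι → k) :
    coneMap k a c A = faceSign k a (A.erase a) * c (A.erase a) := if_pos h

lemma coneMap_of_notMem {a : ι} {A : Finset ι} (h : a ∉ A) (c : Finset ι → k) :
    coneMap k a c A = 0 := if_neg h

lemma linkMap_coneMap_of_notMem {a : ι} {A : Finset ι} (h : a ∉ A) (c : Finset ι → k) :
    linkMap k a (coneMap k a c) A = c A := by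
  rw [linkMap_of_notMem h, coneMap_of_mem (mem_insert_self _ _), erase_insert h, ← mul_assoc,
    faceSign_mul_self, one_mul]

lemma coneMap_linkMap_of_mem {a : ι} {A : Finset ι} (h : a ∈ A) (c : Finset ι → k) :
    coneMap k a (linkMap k a c) A = c A := by
  rw [coneMap_of_mem h, linkMap_of_notMem (notMem_erase a A), insert_erase h, ← mul_assoc,
    faceSign_mul_self, one_mul]

lemma linkMap_coneMap (a : ι) (c : Finset ι → k) :
    linkMap k a (coneMap k a c) = c - coneMap k a (linkMap k a c) := by
  ext A
  rw [Pi.sub_apply]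
  by_cases h : a ∈ A
  · rw [linkMap_of_mem h, coneMap_linkMap_of_mem h, sub_self]
  · rw [linkMap_coneMap_of_notMem h, coneMap_of_notMem h, sub_zero]

lemma linkMap_coneMap_eq_self {a : ι} {c : Finset ι → k} (hc : ∀ A, c A ≠ 0 → a ∉ A) :
    linkMap k a (coneMap k a c) = c := by
  ext A
  by_cases h : a ∈ A
  · rw [linkMap_of_mem h]
    by_contra h'
    exact hc A (Ne.symm h') h
  · exact linkMap_coneMap_of_notMem h c

lemma eq_zero_of_linkMap_eq_zero {a : ι} {c : Finset ι → k} (hc : linkMap k a c = 0)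
    {A : Finset ι} (hA : a ∈ A) : c A = 0 := by
  rw [← coneMap_linkMap_of_mem hA c, hc, map_zero, Pi.zero_apply]

lemma exists_of_linkMap_ne_zero {a : ι} {c : Finset ι → k} {A : Finset ι}
    (h : linkMap k a c A ≠ 0) : a ∉ A ∧ c (insert a A) ≠ 0 := by
  have h1 : a ∉ A := fun h' => h (linkMap_of_mem h' c)
  rw [linkMap_of_notMem h1] at h
  exact ⟨h1, right_ne_zero_of_mul h⟩

lemma exists_of_coneMap_ne_zero {a : ι} {c : Finset ι → k} {A : Finset ι}
    (h : coneMap k a c A ≠ 0) : a ∈ A ∧ c (A.erase a) ≠ 0 := by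
  have h1 : a ∈ A := by
    by_contra h'
    exact h (coneMap_of_notMem h' c)
  rw [coneMap_of_mem h1] at h
  exact ⟨h1, right_ne_zero_of_mul h⟩

variable [Fintype ι] {f : ι → Finset σ}

/-- Once `a` is in a face, `f a` is absorbed by the union, so only `f i \ f a` still matters. The
minus sign comes from moving `a` past the deleted vertex. -/
lemma reducedBoundary_linkMap (a : ι) (c : Finset ι → k) :
    reducedBoundary k (fun i => f i \ f a) (linkMap k a c) =
      -linkMap k a (reducedBoundary k f c) := by
  ext B
  rw [Pi.neg_apply]
  by_cases ha : a ∈ B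
  · rw [linkMap_of_mem ha, neg_zero]
    exact reducedBoundary_eq_zero fun i _ _ => linkMap_of_mem (mem_insert_of_mem ha) c
  · rw [linkMap_of_notMem ha, reducedBoundary_apply, reducedBoundary_apply, mul_sum,
      ← sum_neg_distrib, compl_insert]
    rw [← add_sum_erase (Bᶜ) _ (mem_compl.2 ha), linkMap_of_mem (mem_insert_self _ _), mul_zero,
      zero_add]
    refine sum_congr rfl fun i hi => ?_
    rw [mem_erase, mem_compl] at hi
    have hiff : f i \ f a ⊆ B.biUnion (fun i => f i \ f a) ↔
        f i ⊆ (insert a B).biUnion f := by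
      rw [biUnion_sdiff_const, biUnion_insert]
      constructor
      · intro h x hx
        by_cases hxa : x ∈ f a
        · exact mem_union_left _ hxa
        · exact mem_union_right _ (mem_sdiff.1 (h (mem_sdiff.2 ⟨hx, hxa⟩))).1
      · intro h x hx
        rw [mem_sdiff] at hx ⊢
        exact ⟨(mem_union.1 (h hx.1)).resolve_left hx.2, hx.2⟩
    rw [if_congr hiff rfl rfl, linkMap_of_notMem (by simp [Ne.symm hi.1, ha]), insert_comm a i]
    have h1 := faceSign_mul_comm (R := k) hi.1 hi.2 ha
    linear_combination ((if f i ⊆ (insert a B).biUnion f then (1 : k) else 0) *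
      c (insert i (insert a B))) * h1

lemma reducedBoundary_coneMap_of_notMem {i : ι} (hi : f i = ∅) {B : Finset ι} (hB : i ∉ B)
    (c : Finset ι → k) : reducedBoundary k f (coneMap k i c) B = c B := by
  rw [reducedBoundary_apply, sum_eq_single_of_mem i (mem_compl.2 hB), hi, if_pos (empty_subset _),
    coneMap_of_mem (mem_insert_self _ _), erase_insert hB, mul_one, ← mul_assoc,
    faceSign_mul_self, one_mul]
  intro j hj hji
  rw [coneMap_of_notMem (by simp [Ne.symm hji, hB]), mul_zero]

/-- If one of the sets is empty, the cone over a cycle bounds it. -/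
lemma reducedBoundary_coneMap_eq_self {i : ι} (hi : f i = ∅) {c : Finset ι → k}
    (hc : reducedBoundary k f c = 0) : reducedBoundary k f (coneMap k i c) = c := by
  have hf : (fun j => f j \ f i) = f := by
    ext1 j; rw [hi, sdiff_empty]
  -- Since `f i` is empty, the link has the same family. The boundary is computed directly on faces
  -- without `i`; on the others it is detected by the link.
  have hlink : linkMap k i (reducedBoundary k f (coneMap k i c) - c) = 0 := by
    ext B
    by_cases hB : i ∈ B
    · exact linkMap_of_mem hB _
    · have h := congrFun (reducedBoundary_linkMap (f := f) i (coneMap k i c)) B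
      rw [hf, linkMap_coneMap, map_sub, hc, zero_sub, Pi.neg_apply, Pi.neg_apply, neg_inj,
        reducedBoundary_coneMap_of_notMem hi hB] at h
      rw [map_sub, Pi.sub_apply, ← h, sub_self, Pi.zero_apply]
  ext B
  by_cases hB : i ∈ B
  · exact sub_eq_zero.1 (eq_zero_of_linkMap_eq_zero hlink hB)
  · exact reducedBoundary_coneMap_of_notMem hi hB c

variable {s : Finset ι} {p : ℕ} {m : Finset σ}

lemma not_taylorHomologyNonzero_of_eq_empty {i : ι} (his : i ∈ s) (hi : f i = ∅) :
    ¬ TaylorHomologyNonzero k s f p m := by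
  rintro ⟨c, hc, hc0, hcb⟩
  refine hcb ⟨coneMap k i c, fun A hA => ?_, reducedBoundary_coneMap_eq_self hi hc0⟩
  obtain ⟨h1, h2⟩ := exists_of_coneMap_ne_zero hA
  rw [← insert_erase h1]
  exact insert_subset his (hc _ h2).1

/-- If `f i ⊆ f j`, chains can be moved off `j`. -/
lemma exists_sub_reducedBoundary_of_subset {i j : ι} (his : i ∈ s) (hjs : j ∈ s) (hij : i ≠ j)
    (hf : f i ⊆ f j) {c : Finset ι → k} (hc : ∀ A, c A ≠ 0 → A ⊆ s)
    (hc0 : linkMap k j (reducedBoundary k f c) = 0) :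
    ∃ y : Finset ι → k, (∀ A, y A ≠ 0 → A ⊆ s) ∧
      ∀ A, (c - reducedBoundary k f y) A ≠ 0 → j ∉ A := by
  have hsupp : ∀ A, coneMap k i (linkMap k j c) A ≠ 0 → j ∉ A ∧ insert j A ⊆ s := fun A hA => by
    obtain ⟨h1, h2⟩ := exists_of_coneMap_ne_zero hA
    obtain ⟨h3, h4⟩ := exists_of_linkMap_ne_zero h2
    refine ⟨fun h => h3 (mem_erase.2 ⟨hij.symm, h⟩), insert_subset hjs ?_⟩
    rw [← insert_erase h1]
    exact insert_subset his ((subset_insert _ _).trans (hc _ h4))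
  have hbd : reducedBoundary k (fun l => f l \ f j) (coneMap k i (linkMap k j c)) =
      linkMap k j c := by
    refine reducedBoundary_coneMap_eq_self (f := fun l => f l \ f j)
      (sdiff_eq_empty_iff_subset.2 hf) ?_
    rw [reducedBoundary_linkMap, hc0, neg_zero]
  -- The link of `c` at `j` is a cycle for a family whose `i`-th set is empty, so the cone from `i`
  -- bounds it. Coning this back to `j` cancels the part of `c` through `j`; the sign offsets that
  -- in `reducedBoundary_linkMap`.
  refine ⟨-coneMap k j (coneMap k i (linkMap k j c)), fun A hA => ?_, fun A hA hjA => hA ?_⟩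
  · obtain ⟨h1, h2⟩ := exists_of_coneMap_ne_zero (neg_ne_zero.1 hA)
    have := (hsupp _ h2).2
    rwa [insert_erase h1] at this
  · refine eq_zero_of_linkMap_eq_zero ?_ hjA
    have h := reducedBoundary_linkMap (f := f) j (coneMap k j (coneMap k i (linkMap k j c)))
    rw [linkMap_coneMap_eq_self fun A hA => (hsupp A hA).1, hbd] at h
    rw [map_neg, sub_neg_eq_add, map_add]
    nth_rewrite 1 [h]
    exact neg_add_cancel _

/-- The `j`-th monomial is a multiple of the `i`-th, hence a redundant generator. Cycles and
bounding chains can both be moved off `j`. -/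
lemma taylorHomologyNonzero_erase_iff {i j : ι} (his : i ∈ s) (hjs : j ∈ s) (hij : i ≠ j)
    (hf : f i ⊆ f j) :
    TaylorHomologyNonzero k (s.erase j) f p m ↔ TaylorHomologyNonzero k s f p m := by
  classical
  constructor
  · rintro ⟨c, hc, hc0, hcb⟩
    refine ⟨c, fun A hA => ⟨(hc A hA).1.trans (erase_subset _ _), (hc A hA).2⟩, hc0, ?_⟩
    rintro ⟨b, hb, hbc⟩
    obtain ⟨y, hy, hyb⟩ := exists_sub_reducedBoundary_of_subset his hjs hij hf hb (by
      ext A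
      rw [hbc]
      by_contra h
      exact notMem_erase j s ((hc _ (exists_of_linkMap_ne_zero h).2).1 (mem_insert_self _ _)))
    refine hcb ⟨b - reducedBoundary k f y, fun A hA => subset_erase.2 ⟨?_, hyb A hA⟩, by
      rw [map_sub, reducedBoundary_reducedBoundary, hbc, sub_zero]⟩
    by_cases h : b A = 0
    · rw [Pi.sub_apply, h, zero_sub, neg_ne_zero] at hA
      obtain ⟨l, -, -, hl⟩ := exists_of_reducedBoundary_ne_zero hA
      exact (subset_insert _ _).trans (hy _ hl)
    · exact hb A h
  · rintro ⟨c, hc, hc0, hcb⟩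
    obtain ⟨y, hy, hyc⟩ := exists_sub_reducedBoundary_of_subset his hjs hij hf
      (fun A hA => (hc A hA).1) (by rw [hc0, map_zero])
    let Q : Set (Finset ι) := {A | #A = p ∧ A.biUnion f = m}
    -- The correction `y` need not be homogeneous; only its part of size `p + 1` and multidegree `m`
    -- is used.
    let y' := Set.indicator {A : Finset ι | #A = p + 1 ∧ A.biUnion f = m} y
    have hy' : reducedBoundary k f y' = Q.indicator (reducedBoundary k f y) := by
      refine reducedBoundary_indicator _ _ _ fun B l hl h => ?_
      simp [Q, biUnion_insert_of_subset h, card_insert_of_notMem hl]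
    have hcQ : c = Q.indicator c := by
      ext A
      by_cases h : A ∈ Q
      · rw [Set.indicator_of_mem h]
      · rw [Set.indicator_of_notMem h]
        by_contra h'
        exact h (hc A h').2
    have hy's : ∀ A, y' A ≠ 0 → A ⊆ s := fun A hA => by
      exact hy A (Set.indicator_of_mem (Set.mem_of_indicator_ne_zero hA) y ▸ hA)
    have heq : c - reducedBoundary k f y' = Q.indicator (c - reducedBoundary k f y) := by
      rw [hy', Set.indicator_sub', ← hcQ]
    refine ⟨c - reducedBoundary k f y', fun A hA => ?_, by
      rw [map_sub, reducedBoundary_reducedBoundary, hc0, sub_zero], ?_⟩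
    · rw [heq] at hA
      have hAQ : A ∈ Q := Set.mem_of_indicator_ne_zero hA
      rw [Set.indicator_of_mem hAQ] at hA
      refine ⟨subset_erase.2 ⟨?_, hyc A hA⟩, hAQ⟩
      by_cases h : c A = 0
      · rw [Pi.sub_apply, h, zero_sub, neg_ne_zero] at hA
        obtain ⟨l, -, -, hl⟩ := exists_of_reducedBoundary_ne_zero hA
        exact (subset_insert _ _).trans (hy _ hl)
      · exact (hc A h).1
    · rintro ⟨b, hb, hbc⟩
      refine hcb ⟨b + y', fun A hA => ?_, by rw [map_add, hbc, sub_add_cancel]⟩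
      by_cases h : b A = 0
      · rw [Pi.add_apply, h, zero_add] at hA
        exact hy's A hA
      · exact (hb A h).trans (erase_subset _ _)

lemma notMem_of_notMem_biUnion {ι σ : Type*} [DecidableEq σ] {f : ι → Finset σ} {a : ι} {v : σ} (hv : v ∈ f a) {A : Finset ι}
    (hA : v ∉ A.biUnion f) : a ∉ A :=
  fun h => hA (mem_biUnion.2 ⟨a, h, hv⟩)

/-- A face through `a` has `v` in its union, so it cannot have multidegree `m`. A bounding chain in
other multidegrees is first cut down to `m`. -/
lemma taylorHomologyNonzero_erase_iff_of_notMem {a : ι} {v : σ} (hv : v ∈ f a) (hvm : v ∉ m) :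
    TaylorHomologyNonzero k (s.erase a) f p m ↔ TaylorHomologyNonzero k s f p m := by
  classical
  constructor
  · rintro ⟨c, hc, hc0, hcb⟩
    refine ⟨c, fun A hA => ⟨(hc A hA).1.trans (erase_subset _ _), (hc A hA).2⟩, hc0, ?_⟩
    rintro ⟨b, hb, hbc⟩
    let Q : Set (Finset ι) := {A | A.biUnion f = m}
    refine hcb ⟨Q.indicator b, fun A hA => ?_, ?_⟩
    · have hAQ : A.biUnion f = m := (Set.mem_of_indicator_ne_zero hA : A ∈ Q)
      rw [Set.indicator_of_mem (show A ∈ Q from hAQ)] at hA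
      exact subset_erase.2 ⟨hb A hA, notMem_of_notMem_biUnion hv (hAQ ▸ hvm)⟩
    · rw [reducedBoundary_indicator b Q Q, hbc]
      · ext A
        by_cases h : A ∈ Q
        · rw [Set.indicator_of_mem h]
        · rw [Set.indicator_of_notMem h]
          by_contra h'
          exact h (hc A (Ne.symm h')).2.2
      · intro B i _ h
        simp only [Q, Set.mem_ofPred_eq, biUnion_insert_of_subset h]
  · rintro ⟨c, hc, hc0, hcb⟩
    refine ⟨c, fun A hA => ⟨subset_erase.2 ⟨(hc A hA).1, ?_⟩, (hc A hA).2⟩, hc0, ?_⟩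
    · exact notMem_of_notMem_biUnion hv ((hc A hA).2.2 ▸ hvm)
    · rintro ⟨b, hb, hbc⟩
      exact hcb ⟨b, fun A hA => (hb A hA).trans (erase_subset _ _), hbc⟩

lemma mem_of_mem_biUnion_of_free {ι σ : Type*} [DecidableEq σ] {s : Finset ι}
    {f : ι → Finset σ} {a : ι} {v : σ} (hfree : ∀ i ∈ s, i ≠ a → v ∉ f i)
    {A : Finset ι} (hA : A ⊆ s) (hvA : v ∈ A.biUnion f) : a ∈ A := by
  obtain ⟨i, hi, hvi⟩ := mem_biUnion.1 hvA
  by_cases hia : i = a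
  · exact hia ▸ hi
  · exact absurd hvi (hfree i (hA hi) hia)

/-- If `v` lies in `f a` only, a chain on faces containing `a` has a boundary on such faces. -/
lemma reducedBoundary_eq_zero_of_free {a : ι} {v : σ} (hv : v ∈ f a)
    (hfree : ∀ i ∈ s, i ≠ a → v ∉ f i) {c : Finset ι → k}
    (hc : ∀ A, c A ≠ 0 → A ⊆ s ∧ a ∈ A) {A : Finset ι} (hA : a ∉ A) :
    reducedBoundary k f c A = 0 := by
  by_contra h
  obtain ⟨i, hi, hiA, hci⟩ := exists_of_reducedBoundary_ne_zero h
  obtain ⟨h1, h2⟩ := hc _ hci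
  obtain rfl : a = i := (mem_insert.1 h2).resolve_right hA
  exact hA (mem_of_mem_biUnion_of_free hfree ((subset_insert _ _).trans h1) (hiA hv))

/-- Only `a` contributes `v`, so every face of multidegree `m` contains `a`. Link and cone at `a`
are then inverse on these chains; algebraically this passes to the colon ideal by the monomial of `f
a`. -/
lemma taylorHomologyNonzero_succ_iff_of_mem {a : ι} (has : a ∈ s) {v : σ} (hv : v ∈ f a)
    (hfree : ∀ i ∈ s, i ≠ a → v ∉ f i) (hvm : v ∈ m) :
    TaylorHomologyNonzero k s f (p + 1) m ↔
      f a ⊆ m ∧ TaylorHomologyNonzero k (s.erase a) (fun i => f i \ f a) p (m \ f a) := by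
  constructor
  · intro h
    refine ⟨?_, ?_⟩
    · obtain ⟨A, hA, -, rfl⟩ := h.exists_biUnion_eq
      exact subset_biUnion_of_mem f (mem_of_mem_biUnion_of_free hfree hA hvm)
    · obtain ⟨c, hc, hc0, hcb⟩ := h
      refine ⟨linkMap k a c, fun A hA => ?_, by rw [reducedBoundary_linkMap, hc0, map_zero,
        neg_zero], ?_⟩
      · obtain ⟨h1, h2⟩ := exists_of_linkMap_ne_zero hA
        obtain ⟨h3, h4, h5⟩ := hc _ h2
        rw [card_insert_of_notMem h1] at h4
        refine ⟨subset_erase.2 ⟨(subset_insert _ _).trans h3, h1⟩, by omega, ?_⟩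
        rw [biUnion_sdiff_const, ← h5, biUnion_insert, union_sdiff_left]
      · rintro ⟨b, hb, hbc⟩
        have hba : ∀ A, b A ≠ 0 → a ∉ A := fun A hA => (subset_erase.1 (hb A hA)).2
        have hsupp : ∀ A, (-coneMap k a b) A ≠ 0 → A ⊆ s ∧ a ∈ A := fun A hA => by
          obtain ⟨h1, h2⟩ := exists_of_coneMap_ne_zero (neg_ne_zero.1 hA)
          refine ⟨?_, h1⟩
          rw [← insert_erase h1]
          exact insert_subset has ((hb _ h2).trans (erase_subset _ _))
        refine hcb ⟨-coneMap k a b, fun A hA => (hsupp A hA).1, ?_⟩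
        ext A
        by_cases haA : a ∈ A
        · refine sub_eq_zero.1 (eq_zero_of_linkMap_eq_zero (a := a)
            (c := reducedBoundary k f (-coneMap k a b) - c) ?_ haA)
          have h := reducedBoundary_linkMap (f := f) a (-coneMap k a b)
          rw [map_neg, linkMap_coneMap_eq_self hba, map_neg, hbc, neg_inj] at h
          rw [map_sub, ← h, sub_self]
        · rw [reducedBoundary_eq_zero_of_free hv hfree hsupp haA]
          by_contra h'
          obtain ⟨h1, h2, h3⟩ := hc A (Ne.symm h')
          exact haA (mem_of_mem_biUnion_of_free hfree h1 (h3 ▸ hvm))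
  · rintro ⟨ham, c, hc, hc0, hcb⟩
    have hca : ∀ A, c A ≠ 0 → a ∉ A := fun A hA => (subset_erase.1 (hc A hA).1).2
    have hsupp : ∀ A, coneMap k a c A ≠ 0 → A ⊆ s ∧ #A = p + 1 ∧ A.biUnion f = m := by
      intro A hA
      obtain ⟨h1, h2⟩ := exists_of_coneMap_ne_zero hA
      obtain ⟨h3, h4, h5⟩ := hc _ h2
      rw [biUnion_sdiff_const] at h5
      rw [← insert_erase h1]
      refine ⟨insert_subset has (h3.trans (erase_subset _ _)), ?_, ?_⟩
      · rw [card_insert_of_notMem (notMem_erase _ _), h4]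
      · rw [biUnion_insert, ← union_sdiff_self_eq_union, h5, union_sdiff_of_subset ham]
    refine ⟨coneMap k a c, hsupp, ?_, ?_⟩
    · ext A
      by_cases haA : a ∈ A
      · refine eq_zero_of_linkMap_eq_zero (a := a) ?_ haA
        rw [← neg_eq_zero, ← reducedBoundary_linkMap, linkMap_coneMap_eq_self hca, hc0]
      · exact reducedBoundary_eq_zero_of_free hv hfree
          (fun A hA => ⟨(hsupp A hA).1, (exists_of_coneMap_ne_zero hA).1⟩) haA
    · rintro ⟨b, hb, hbc⟩
      refine hcb ⟨-linkMap k a b, fun A hA => ?_, ?_⟩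
      · obtain ⟨h1, h2⟩ := exists_of_linkMap_ne_zero (neg_ne_zero.1 hA)
        exact subset_erase.2 ⟨(subset_insert _ _).trans (hb _ h2), h1⟩
      · rw [map_neg, reducedBoundary_linkMap, neg_neg, hbc, linkMap_coneMap_eq_self hca]

/-! ### Forests and the recursion on leaves -/

/-- Every nonempty subfamily of `(f i)_{i ∈ s}` has a leaf. -/
def IsForestFamily {ι σ : Type*} [DecidableEq σ] (s : Finset ι) (f : ι → Finset σ) : Prop :=
  ∀ t ⊆ s, t.Nonempty → ∃ a ∈ t, t = {a} ∨ ∃ b ∈ t, b ≠ a ∧ ∀ h ∈ t, h ≠ a → f a ∩ f h ⊆ f b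

lemma IsForestFamily.mono {ι σ : Type*} [DecidableEq σ] {s t : Finset ι} {f : ι → Finset σ}
    (h : IsForestFamily s f) (hts : t ⊆ s) : IsForestFamily t f :=
  fun u hu => h u (hu.trans hts)

/-- The leaf condition survives intersecting with a complement. Sets may become empty, equal or
nested, which is why forests are treated as indexed families. -/
lemma IsForestFamily.sdiff {ι σ : Type*} [DecidableEq σ] {s : Finset ι} {f : ι → Finset σ}
    (h : IsForestFamily s f) (W : Finset σ) : IsForestFamily s fun i => f i \ W := by
  intro t ht hne
  obtain ⟨a, ha, h1⟩ := h t ht hne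
  refine ⟨a, ha, h1.imp_right ?_⟩
  rintro ⟨b, hb, hba, h2⟩
  refine ⟨b, hb, hba, fun l hl hla x hx => ?_⟩
  simp only [mem_inter, mem_sdiff] at hx ⊢
  exact ⟨h2 l hl hla (mem_inter.2 ⟨hx.1.1, hx.2.1⟩), hx.1.2⟩

/-- One step of the recursion: the multidegree containing the removed set `f l` goes up by one
homological degree, the other one does not. -/
lemma exists_taylorHomologyNonzero_pair {l : ι} (hls : l ∈ s) {v : σ} (hv : v ∈ f l)
    (hfree : ∀ i ∈ s, i ≠ l → v ∉ f i) {a b : ℕ} {m₁ m₂ : Finset σ}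
    (h₁ : TaylorHomologyNonzero k (s.erase l) (fun i => f i \ f l) a m₁)
    (h₂ : TaylorHomologyNonzero k (s.erase l) (fun i => f i \ f l) b m₂) :
    ∃ m₁' m₂', TaylorHomologyNonzero k s f (a + 1) m₁' ∧ TaylorHomologyNonzero k s f b m₂' ∧
      m₁ ∪ m₂ ∪ f l ⊆ m₁' ∪ m₂' := by
  -- The second class lifts to the original sets without `f l`; its multidegree misses `v`, so
  -- restoring `f l` does not affect it.
  obtain ⟨m₂', rfl, h₂'⟩ := h₂.exists_of_sdiff
  have hdisj : (m₁ ∪ f l) \ f l = m₁ := by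
    obtain ⟨A, -, -, rfl⟩ := h₁.exists_biUnion_eq
    rw [biUnion_sdiff_const, sdiff_union_self_eq_union, union_sdiff_right]
  have hv₂ : v ∉ m₂' := by
    obtain ⟨A, hA, -, rfl⟩ := h₂'.exists_biUnion_eq
    intro h
    exact (subset_erase.1 hA).2
      (mem_of_mem_biUnion_of_free hfree (hA.trans (erase_subset _ _)) h)
  refine ⟨m₁ ∪ f l, m₂', ?_, (taylorHomologyNonzero_erase_iff_of_notMem hv hv₂).1 h₂', ?_⟩
  · rw [taylorHomologyNonzero_succ_iff_of_mem hls hv hfree (mem_union_right _ hv), hdisj]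
    exact ⟨subset_union_right, h₁⟩
  · intro x
    simp only [mem_union, mem_sdiff]
    tauto

/-- The homology of the reduced Taylor complex of a forest is generated in a subadditive way. -/
theorem IsForestFamily.exists_taylorHomologyNonzero (hf : IsForestFamily s f) {a b : ℕ}
    (h : TaylorHomologyNonzero k s f (a + b) m) :
    ∃ m₁ m₂, TaylorHomologyNonzero k s f a m₁ ∧ TaylorHomologyNonzero k s f b m₂ ∧
      m ⊆ m₁ ∪ m₂ := by
  induction hs : #s generalizing s f a b m with
  | zero =>
    obtain rfl := card_eq_zero.1 hs
    obtain ⟨A, hA, hcard, -⟩ := h.exists_biUnion_eq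
    rw [subset_empty.1 hA, card_empty] at hcard
    obtain ⟨rfl, rfl⟩ : a = 0 ∧ b = 0 := by omega
    exact ⟨m, m, h, h, subset_union_left⟩
  | succ N ih =>
    obtain ⟨l, hls, hl⟩ := hf s subset_rfl (card_pos.1 (by omega))
    -- A leaf whose joint `f j` does not contain it has a vertex outside `f j`; such a vertex lies
    -- in no other set.
    have hcase : f l = ∅ ∨ (∃ j ∈ s, j ≠ l ∧ f l ⊆ f j) ∨
        ∃ v ∈ f l, ∀ i ∈ s, i ≠ l → v ∉ f i := by
      rcases hl with rfl | ⟨j, hj, hjl, hjoint⟩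
      · rcases (f l).eq_empty_or_nonempty with h0 | ⟨v, hv⟩
        · exact Or.inl h0
        · exact Or.inr (Or.inr ⟨v, hv, fun i hi hil => absurd (mem_singleton.1 hi) hil⟩)
      · by_cases hsub : f l ⊆ f j
        · exact Or.inr (Or.inl ⟨j, hj, hjl, hsub⟩)
        · obtain ⟨v, hv, hvj⟩ := not_subset.1 hsub
          exact Or.inr (Or.inr ⟨v, hv, fun i hi hil hvi =>
            hvj (hjoint i hi hil (mem_inter.2 ⟨hv, hvi⟩))⟩)
    rcases hcase with h0 | ⟨j, hj, hjl, hsub⟩ | ⟨v, hv, hfree⟩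
    · exact absurd h (not_taylorHomologyNonzero_of_eq_empty hls h0)
    -- The larger set `f j` is removed, not the leaf.
    · simp only [← taylorHomologyNonzero_erase_iff hls hj hjl.symm hsub] at h ⊢
      exact ih (hf.mono (erase_subset _ _)) h (by rw [card_erase_of_mem hj, hs]; rfl)
    · have hcard : #(s.erase l) = N := by rw [card_erase_of_mem hls, hs]; rfl
      by_cases hvm : v ∈ m
      · obtain ⟨q, hq⟩ : ∃ q, a + b = q + 1 := by
          refine Nat.exists_eq_succ_of_ne_zero fun h0 => ?_
          rw [h0] at h
          obtain ⟨A, -, hA, rfl⟩ := h.exists_biUnion_eq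
          rw [card_eq_zero.1 hA] at hvm
          simp at hvm
        rw [hq, taylorHomologyNonzero_succ_iff_of_mem hls hv hfree hvm] at h
        obtain ⟨hlm, h⟩ := h
        have hf' : IsForestFamily (s.erase l) fun i => f i \ f l :=
          (hf.mono (erase_subset _ _)).sdiff _
        have hm : ∀ {m₁ m₂ : Finset σ}, m \ f l ⊆ m₁ ∪ m₂ → m ⊆ m₁ ∪ m₂ ∪ f l :=
          fun h => by
            rw [← sdiff_union_of_subset hlm]
            exact union_subset_union_left h
        -- The degree lost in the link is charged to `a` when `a` is positive, and to `b` otherwise.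
        rcases a with _ | a
        · obtain ⟨b, rfl⟩ : ∃ b', b = b' + 1 := ⟨q, by omega⟩
          rw [show q = b + 0 by omega] at h
          obtain ⟨m₁, m₂, h₁, h₂, h₃⟩ := ih hf' h hcard
          obtain ⟨m₁', m₂', h₁', h₂', h₃'⟩ :=
            exists_taylorHomologyNonzero_pair hls hv hfree h₁ h₂
          exact ⟨m₂', m₁', h₂', h₁', by rw [union_comm]; exact (hm h₃).trans h₃'⟩
        · rw [show q = a + b by omega] at h
          obtain ⟨m₁, m₂, h₁, h₂, h₃⟩ := ih hf' h hcard
          obtain ⟨m₁', m₂', h₁', h₂', h₃'⟩ :=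
            exists_taylorHomologyNonzero_pair hls hv hfree h₁ h₂
          exact ⟨m₁', m₂', h₁', h₂', (hm h₃).trans h₃'⟩
      · rw [← taylorHomologyNonzero_erase_iff_of_notMem hv hvm] at h
        obtain ⟨m₁, m₂, h₁, h₂, h₃⟩ := ih (hf.mono (erase_subset _ _)) h hcard
        have hfr : ∀ {q : ℕ} {m' : Finset σ}, TaylorHomologyNonzero k (s.erase l) f q m' →
            TaylorHomologyNonzero k s f q m' := fun {q m'} h' => by
          refine (taylorHomologyNonzero_erase_iff_of_notMem hv fun hvm' => ?_).1 h'
          obtain ⟨A, hA, -, rfl⟩ := h'.exists_biUnion_eq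
          exact (subset_erase.1 hA).2
            (mem_of_mem_biUnion_of_free hfree (hA.trans (erase_subset _ _)) hvm')
        exact ⟨m₁, m₂, hfr h₁, hfr h₂, h₃⟩

end ReducedTaylor

/-! ### Degree-preserving maps and reduction modulo the variables -/

section GradedFree

variable {σ k : Type*} [Field k] {ι κ μ : Type*}

/-- A linear map `⊕_e S(-s e) → ⊕_e S(-t e)` preserves degrees. -/
def IsGradedMap [DecidableEq ι] (s : ι → ℕ) (t : κ → ℕ)
    (φ : (ι → MvPolynomial σ k) →ₗ[MvPolynomial σ k] (κ → MvPolynomial σ k)) : Prop :=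
  ∀ e e', φ (Pi.single e 1) e' = 0 ∨
    ∃ m, t e' + m = s e ∧ (φ (Pi.single e 1) e').IsHomogeneous m

/-- The component of degree `j` of an element of `⊕_e S(-s e)`. -/
noncomputable def gradedPart (s : ι → ℕ) (j : ℕ) :
    (ι → MvPolynomial σ k) →ₗ[k] (ι → MvPolynomial σ k) :=
  LinearMap.pi fun e =>
    (if s e ≤ j then MvPolynomial.homogeneousComponent (j - s e) else 0) ∘ₗ LinearMap.proj e

lemma gradedPart_apply (s : ι → ℕ) (j : ℕ) (x : ι → MvPolynomial σ k) (e : ι) :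
    gradedPart s j x e =
      if s e ≤ j then MvPolynomial.homogeneousComponent (j - s e) (x e) else 0 := by
  simp only [gradedPart, LinearMap.pi_apply, LinearMap.comp_apply, LinearMap.proj_apply]
  split_ifs <;> rfl

lemma homogeneousComponent_mul_of_isHomogeneous {p q : MvPolynomial σ k} {m : ℕ}
    (hq : q.IsHomogeneous m) (n : ℕ) :
    MvPolynomial.homogeneousComponent n (p * q) =
      if m ≤ n then MvPolynomial.homogeneousComponent (n - m) p * q else 0 := by
  let := MvPolynomial.gradedAlgebra (σ := σ) (R := k)
  have hcomp : ∀ (r : MvPolynomial σ k) (i : ℕ),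
      (DirectSum.decompose (MvPolynomial.homogeneousSubmodule σ k) r i : MvPolynomial σ k) =
        MvPolynomial.homogeneousComponent i r := MvPolynomial.decomposition.decompose'_apply
  have h := DirectSum.coe_decompose_mul_of_right_mem
    (𝒜 := MvPolynomial.homogeneousSubmodule σ k) (a := p) n hq
  simpa only [hcomp] using h

lemma linearMap_apply_eq_sum [Fintype ι] [DecidableEq ι] {R : Type*} [CommRing R]
    (φ : (ι → R) →ₗ[R] (κ → R)) (x : ι → R) (e' : κ) :
    φ x e' = ∑ e, x e * φ (Pi.single e 1) e' := by
  conv_lhs => rw [pi_eq_sum_univ' x, map_sum, Finset.sum_apply]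
  refine sum_congr rfl fun e _ => ?_
  rw [map_smul, Pi.smul_apply, smul_eq_mul]

lemma IsGradedMap.map_gradedPart [Fintype ι] [DecidableEq ι] {s : ι → ℕ} {t : κ → ℕ}
    {φ : (ι → MvPolynomial σ k) →ₗ[MvPolynomial σ k] (κ → MvPolynomial σ k)}
    (hφ : IsGradedMap s t φ) (j : ℕ) (x : ι → MvPolynomial σ k) :
    φ (gradedPart s j x) = gradedPart t j (φ x) := by
  ext1 e'
  rw [gradedPart_apply, linearMap_apply_eq_sum φ, linearMap_apply_eq_sum φ x, map_sum]
  have key : ∀ e, gradedPart s j x e * φ (Pi.single e 1) e' =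
      if t e' ≤ j then MvPolynomial.homogeneousComponent (j - t e')
        (x e * φ (Pi.single e 1) e') else 0 := fun e => by
    rcases hφ e e' with h | ⟨m, hm, h⟩
    · simp [h]
    · rw [homogeneousComponent_mul_of_isHomogeneous h, gradedPart_apply]
      by_cases h1 : s e ≤ j
      · rw [if_pos h1, if_pos (by omega), if_pos (by omega)]
        congr 3
        omega
      · rw [if_neg h1, zero_mul]
        split_ifs with h2 h3
        · omega
        · rfl
        · rfl
  rw [sum_congr rfl fun e _ => key e]
  split_ifs <;> simp

lemma gradedPart_eq_zero_or_isHomogeneous {t : κ → ℕ} {j : ℕ} (x : κ → MvPolynomial σ k) (e' : κ) :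
    gradedPart t j x e' = 0 ∨ ∃ m, t e' + m = j ∧ (gradedPart t j x e').IsHomogeneous m := by
  rw [gradedPart_apply]
  split_ifs with h
  · exact Or.inr ⟨j - t e', by omega, MvPolynomial.homogeneousComponent_isHomogeneous _ _⟩
  · exact Or.inl rfl

lemma IsGradedMap.gradedPart_single [DecidableEq ι] {s : ι → ℕ} {t : κ → ℕ}
    {φ : (ι → MvPolynomial σ k) →ₗ[MvPolynomial σ k] (κ → MvPolynomial σ k)}
    (hφ : IsGradedMap s t φ) (e : ι) :
    gradedPart t (s e) (φ (Pi.single e 1)) = φ (Pi.single e 1) := by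
  ext1 e'
  rw [gradedPart_apply]
  rcases hφ e e' with h | ⟨m, hm, h⟩
  · simp [h]
  · rw [if_pos (by omega), show s e - t e' = m by omega]
    exact MvPolynomial.homogeneousComponent_eq_self h

lemma IsGradedMap.comp [Fintype κ] [DecidableEq ι] [DecidableEq κ]
    {s : ι → ℕ} {t : κ → ℕ} {u : μ → ℕ}
    {ψ : (κ → MvPolynomial σ k) →ₗ[MvPolynomial σ k] (μ → MvPolynomial σ k)}
    {φ : (ι → MvPolynomial σ k) →ₗ[MvPolynomial σ k] (κ → MvPolynomial σ k)}
    (hψ : IsGradedMap t u ψ) (hφ : IsGradedMap s t φ) : IsGradedMap s u (ψ ∘ₗ φ) := by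
  intro e e'
  rw [LinearMap.comp_apply, ← hφ.gradedPart_single, hψ.map_gradedPart]
  exact gradedPart_eq_zero_or_isHomogeneous _ _

lemma exists_linearMap_single [Fintype ι] [DecidableEq ι] {R M : Type*} [CommRing R]
    [AddCommGroup M] [Module R M] (y : ι → M) :
    ∃ φ : (ι → R) →ₗ[R] M, ∀ e, φ (Pi.single e 1) = y e :=
  ⟨(Pi.basisFun R ι).constr R y, fun e => by
    rw [← Pi.basisFun_apply R ι e, Module.Basis.constr_basis]⟩

lemma linearMap_ext_single [Fintype ι] [DecidableEq ι] {R M : Type*} [CommRing R]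
    [AddCommGroup M] [Module R M] {φ ψ : (ι → R) →ₗ[R] M}
    (h : ∀ e, φ (Pi.single e 1) = ψ (Pi.single e 1)) : φ = ψ :=
  (Pi.basisFun R ι).ext fun e => by simpa only [Pi.basisFun_apply] using h e

lemma exists_linearMap_comp_eq [Fintype ι] [DecidableEq ι] {R M N : Type*} [CommRing R]
    [AddCommGroup M] [Module R M] [AddCommGroup N] [Module R N]
    {δ : M →ₗ[R] N} {g : (ι → R) →ₗ[R] N} (h : ∀ x, ∃ y, δ y = g x) :
    ∃ φ : (ι → R) →ₗ[R] M, δ ∘ₗ φ = g := by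
  choose y hy using h
  obtain ⟨φ, hφ⟩ := exists_linearMap_single (R := R) fun e : ι => y (Pi.single e 1)
  exact ⟨φ, linearMap_ext_single fun e => by rw [LinearMap.comp_apply, hφ, hy]⟩

/-- Any lift of a basis element may be replaced by its component of the right degree, because `δ`
commutes with taking components. -/
lemma IsGradedMap.exists_comp_eq [Fintype ι] [DecidableEq ι] [Fintype κ] [DecidableEq κ]
    {s : ι → ℕ} {t : κ → ℕ} {u : μ → ℕ}
    {δ : (κ → MvPolynomial σ k) →ₗ[MvPolynomial σ k] (μ → MvPolynomial σ k)}
    {g : (ι → MvPolynomial σ k) →ₗ[MvPolynomial σ k] (μ → MvPolynomial σ k)}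
    (hδ : IsGradedMap t u δ) (hg : IsGradedMap s u g) (h : ∀ x, ∃ y, δ y = g x) :
    ∃ φ, IsGradedMap s t φ ∧ δ ∘ₗ φ = g := by
  choose y hy using h
  obtain ⟨φ, hφ⟩ := exists_linearMap_single (R := MvPolynomial σ k)
    fun e : ι => gradedPart t (s e) (y (Pi.single e 1))
  refine ⟨φ, fun e e' => ?_, linearMap_ext_single fun e => ?_⟩
  · rw [hφ]
    exact gradedPart_eq_zero_or_isHomogeneous _ _
  · rw [LinearMap.comp_apply, hφ, hδ.map_gradedPart, hy, hg.gradedPart_single]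

/-- The reduction of a map of free modules modulo the variables. -/
noncomputable def reduceMap [Fintype ι] [DecidableEq ι]
    (φ : (ι → MvPolynomial σ k) →ₗ[MvPolynomial σ k] (κ → MvPolynomial σ k)) :
    (ι → k) →ₗ[k] (κ → k) :=
  Matrix.mulVecLin ((LinearMap.toMatrix' φ).map MvPolynomial.constantCoeff)

lemma reduceMap_apply [Fintype ι] [DecidableEq ι]
    (φ : (ι → MvPolynomial σ k) →ₗ[MvPolynomial σ k] (κ → MvPolynomial σ k)) (x : ι → k) (e' : κ) :
    reduceMap φ x e' =
      ∑ e, MvPolynomial.constantCoeff (φ (Pi.single e 1) e') * x e := by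
  simp [reduceMap, Matrix.mulVec, dotProduct, LinearMap.toMatrix'_apply]

lemma reduceMap_comp [Fintype ι] [DecidableEq ι] [Fintype κ] [DecidableEq κ]
    (ψ : (κ → MvPolynomial σ k) →ₗ[MvPolynomial σ k] (μ → MvPolynomial σ k))
    (φ : (ι → MvPolynomial σ k) →ₗ[MvPolynomial σ k] (κ → MvPolynomial σ k)) :
    reduceMap (ψ ∘ₗ φ) = reduceMap ψ ∘ₗ reduceMap φ := by
  rw [reduceMap, LinearMap.toMatrix'_comp, Matrix.map_mul, Matrix.mulVecLin_mul]
  rfl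

lemma reduceMap_id [Fintype ι] [DecidableEq ι] :
    reduceMap (LinearMap.id : (ι → MvPolynomial σ k) →ₗ[MvPolynomial σ k] _) = LinearMap.id := by
  rw [reduceMap, LinearMap.toMatrix'_id, Matrix.map_one _ (map_zero _) (map_one _),
    Matrix.mulVecLin_one]

lemma reduceMap_add [Fintype ι] [DecidableEq ι]
    (φ ψ : (ι → MvPolynomial σ k) →ₗ[MvPolynomial σ k] (κ → MvPolynomial σ k)) :
    reduceMap (φ + ψ) = reduceMap φ + reduceMap ψ := by
  ext x e'
  simp [reduceMap_apply, add_mul, sum_add_distrib]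

lemma reduceMap_sub [Fintype ι] [DecidableEq ι]
    (φ ψ : (ι → MvPolynomial σ k) →ₗ[MvPolynomial σ k] (κ → MvPolynomial σ k)) :
    reduceMap (φ - ψ) = reduceMap φ - reduceMap ψ := by
  ext x e'
  simp [reduceMap_apply, sub_mul, sum_sub_distrib]

lemma IsGradedMap.reduceMap_apply_eq_zero [Fintype ι] [DecidableEq ι] {s : ι → ℕ} {t : κ → ℕ}
    {φ : (ι → MvPolynomial σ k) →ₗ[MvPolynomial σ k] (κ → MvPolynomial σ k)}
    (hφ : IsGradedMap s t φ) {j : ℕ} {x : ι → k} (hx : ∀ e, s e ≠ j → x e = 0) {e' : κ}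
    (he' : t e' ≠ j) : reduceMap φ x e' = 0 := by
  rw [reduceMap_apply]
  refine sum_eq_zero fun e _ => ?_
  by_cases hs : s e = j
  · rcases hφ e e' with h | ⟨m, hm, h⟩
    · rw [h, map_zero, zero_mul]
    · rw [MvPolynomial.constantCoeff_eq, h.coeff_eq_zero, zero_mul]
      rw [map_zero]
      omega
  · rw [hx e hs, mul_zero]

end GradedFree

/-! ### Comparison of resolutions and Tor -/

/-- A graded free resolution `⋯ → F₁ → F₀ → S/I → 0` by finitely generated modules, not necessarily
minimal, with bases indexed by arbitrary finite types. -/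
structure GradedFreeResolution {σ k : Type*} [Field k] (I : Ideal (MvPolynomial σ k)) where
  /-- The index type of the basis of `F_i`. -/
  idx : ℕ → Type
  [fintype : ∀ i, Fintype (idx i)]
  [decEq : ∀ i, DecidableEq (idx i)]
  /-- The degrees of the basis elements of `F_i`. -/
  shift : (i : ℕ) → idx i → ℕ
  /-- The differential `F_{i+1} → F_i`. -/
  d : (i : ℕ) → (idx (i + 1) → MvPolynomial σ k) →ₗ[MvPolynomial σ k]
    (idx i → MvPolynomial σ k)
  /-- The augmentation `F₀ → S/I`. -/
  aug : (idx 0 → MvPolynomial σ k) →ₗ[MvPolynomial σ k] (MvPolynomial σ k ⧸ I)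
  aug_surjective : Function.Surjective aug
  exact_zero : Function.Exact (d 0) aug
  exact_succ : ∀ i, Function.Exact (d (i + 1)) (d i)
  aug_graded : ∀ e, ∃ f : MvPolynomial σ k, f.IsHomogeneous (shift 0 e) ∧
    aug (Pi.single e 1) = Ideal.Quotient.mk I f
  d_graded : ∀ i, IsGradedMap (shift (i + 1)) (shift i) (d i)

namespace GradedFreeResolution

attribute [instance] GradedFreeResolution.fintype GradedFreeResolution.decEq

variable {σ k : Type*} [Field k] {I : Ideal (MvPolynomial σ k)}

/-- The quotient carries no explicit grading here, so `Q.aug` is factored through a graded map `α`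
to the polynomial ring. Lifts are made homogeneous there, and `hI` keeps the error in `I`. -/
lemma exists_augmentation_lift (hI : ∀ p ∈ I, ∀ n, MvPolynomial.homogeneousComponent n p ∈ I)
    (P Q : GradedFreeResolution I) :
    ∃ φ : (P.idx 0 → MvPolynomial σ k) →ₗ[MvPolynomial σ k] (Q.idx 0 → MvPolynomial σ k),
      IsGradedMap (P.shift 0) (Q.shift 0) φ ∧ Q.aug ∘ₗ φ = P.aug := by
  choose f hf hfa using P.aug_graded
  choose g hg hga using Q.aug_graded
  choose y hy using fun e => Q.aug_surjective (Ideal.Quotient.mk I (f e))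
  obtain ⟨α, hα⟩ := exists_linearMap_single (R := MvPolynomial σ k)
    fun (e : Q.idx 0) (_ : Unit) => g e
  have hαg : IsGradedMap (Q.shift 0) (fun _ : Unit => 0) α := fun e e' => by
    rw [hα]
    exact Or.inr ⟨_, zero_add _, hg e⟩
  have haug : ∀ x, Q.aug x = Ideal.Quotient.mk I (α x ()) := fun x => by
    rw [linearMap_apply_eq_sum α, map_sum]
    conv_lhs => rw [pi_eq_sum_univ' x, map_sum]
    refine sum_congr rfl fun e _ => ?_
    rw [map_smul, hα, map_mul, hga e]
    rfl
  obtain ⟨φ, hφ⟩ := exists_linearMap_single (R := MvPolynomial σ k)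
    fun e : P.idx 0 => gradedPart (Q.shift 0) (P.shift 0 e) (y e)
  refine ⟨φ, fun e e' => ?_, linearMap_ext_single fun e => ?_⟩
  · rw [hφ]
    exact gradedPart_eq_zero_or_isHomogeneous _ _
  · rw [LinearMap.comp_apply, hφ, haug, hαg.map_gradedPart, hfa, Ideal.Quotient.eq,
      gradedPart_apply, if_pos (Nat.zero_le _), Nat.sub_zero]
    have h1 := hy e
    rw [haug, Ideal.Quotient.eq] at h1
    have h2 := hI _ h1 (P.shift 0 e)
    rwa [map_sub, MvPolynomial.homogeneousComponent_eq_self (hf e)] at h2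

lemma exists_seq_of_step {X : ℕ → Type*} (good : ∀ i, X i → Prop)
    (rel : ∀ i, X i → X (i + 1) → Prop) (h0 : ∃ x, good 0 x)
    (hstep : ∀ i x, good i x → ∃ y, good (i + 1) y ∧ rel i x y) :
    ∃ f : ∀ i, X i, (∀ i, good i (f i)) ∧ ∀ i, rel i (f i) (f (i + 1)) := by
  choose x0 hx0 using h0
  choose next hnext hrel using hstep
  let F : ∀ i, {x : X i // good i x} := fun i =>
    Nat.rec ⟨x0, hx0⟩ (fun i x => ⟨next i x.1 x.2, hnext i x.1 x.2⟩) i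
  exact ⟨fun i => (F i).1, fun i => (F i).2, fun i => hrel i (F i).1 (F i).2⟩

/-- Degree preserving comparison maps between two resolutions of the same module. -/
lemma exists_chainMap (hI : ∀ p ∈ I, ∀ n, MvPolynomial.homogeneousComponent n p ∈ I)
    (P Q : GradedFreeResolution I) :
    ∃ φ : ∀ i, (P.idx i → MvPolynomial σ k) →ₗ[MvPolynomial σ k] (Q.idx i → MvPolynomial σ k),
      (∀ i, IsGradedMap (P.shift i) (Q.shift i) (φ i)) ∧ Q.aug ∘ₗ φ 0 = P.aug ∧
        ∀ i, Q.d i ∘ₗ φ (i + 1) = φ i ∘ₗ P.d i := by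
  obtain ⟨φ₀, hφ₀, hφ₀a⟩ := exists_augmentation_lift hI P Q
  obtain ⟨φ, hgood, hrel⟩ := exists_seq_of_step
    (X := fun i => (P.idx i → MvPolynomial σ k) →ₗ[MvPolynomial σ k] (Q.idx i → MvPolynomial σ k))
    -- The invariant records that the next lift exists; its last clause pins the initial term to
    -- `φ₀`.
    (fun i φ => IsGradedMap (P.shift i) (Q.shift i) φ ∧ (∀ x, ∃ y, Q.d i y = (φ ∘ₗ P.d i) x) ∧
      ∀ h : i = 0, φ = h ▸ φ₀)
    (fun i φ ψ => Q.d i ∘ₗ ψ = φ ∘ₗ P.d i)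
    ⟨φ₀, hφ₀, fun x => (Q.exact_zero _).1 (by
      rw [LinearMap.comp_apply, ← LinearMap.comp_apply, hφ₀a]
      exact P.exact_zero.apply_apply_eq_zero x), fun _ => rfl⟩ (by
    rintro i φ ⟨hφ, hφd, -⟩
    obtain ⟨ψ, hψ, hψd⟩ := (Q.d_graded i).exists_comp_eq (hφ.comp (P.d_graded i)) hφd
    refine ⟨ψ, ⟨hψ, fun x => (Q.exact_succ i _).1 ?_, fun h => absurd h (Nat.succ_ne_zero i)⟩,
      hψd⟩
    rw [LinearMap.comp_apply, ← LinearMap.comp_apply, hψd, LinearMap.comp_apply,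
      (P.exact_succ i).apply_apply_eq_zero x, map_zero])
  refine ⟨φ, fun i => (hgood i).1, ?_, hrel⟩
  rw [(hgood 0).2.2 rfl]
  exact hφ₀a

/-- No grading is asked of the homotopy: it only has to show that a reduced cycle is a boundary. -/
lemma exists_homotopy (P : GradedFreeResolution I)
    (θ : ∀ i, (P.idx i → MvPolynomial σ k) →ₗ[MvPolynomial σ k] (P.idx i → MvPolynomial σ k))
    (hθ₀ : P.aug ∘ₗ θ 0 = 0) (hθ : ∀ i, P.d i ∘ₗ θ (i + 1) = θ i ∘ₗ P.d i) :
    ∃ h : ∀ i, (P.idx i → MvPolynomial σ k) →ₗ[MvPolynomial σ k]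
        (P.idx (i + 1) → MvPolynomial σ k),
      P.d 0 ∘ₗ h 0 = θ 0 ∧ ∀ i, P.d (i + 1) ∘ₗ h (i + 1) + h i ∘ₗ P.d i = θ (i + 1) := by
  obtain ⟨h₀, hh₀⟩ := exists_linearMap_comp_eq (δ := P.d 0) (g := θ 0) fun x =>
    (P.exact_zero _).1 (by rw [← LinearMap.comp_apply, hθ₀, LinearMap.zero_apply])
  obtain ⟨h, hgood, hrel⟩ := exists_seq_of_step
    (X := fun i => (P.idx i → MvPolynomial σ k) →ₗ[MvPolynomial σ k]
      (P.idx (i + 1) → MvPolynomial σ k))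
    (fun i h => P.d i ∘ₗ h ∘ₗ P.d i = θ i ∘ₗ P.d i ∧ ∀ e : i = 0, h = e ▸ h₀)
    (fun i h h' => P.d (i + 1) ∘ₗ h' + h ∘ₗ P.d i = θ (i + 1))
    ⟨h₀, by rw [← LinearMap.comp_assoc, hh₀], fun _ => rfl⟩ (by
    rintro i h ⟨hh, -⟩
    obtain ⟨h', hh'⟩ := exists_linearMap_comp_eq (δ := P.d (i + 1))
      (g := θ (i + 1) - h ∘ₗ P.d i) fun x => (P.exact_succ i _).1 (by
        rw [← LinearMap.comp_apply, LinearMap.comp_sub, hθ, hh, sub_self, LinearMap.zero_apply])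
    have hdd : P.d i ∘ₗ P.d (i + 1) = 0 :=
      LinearMap.ext fun x => (P.exact_succ i).apply_apply_eq_zero x
    refine ⟨h', ⟨?_, fun e => absurd e (Nat.succ_ne_zero i)⟩, by rw [hh', sub_add_cancel]⟩
    rw [← LinearMap.comp_assoc, hh', LinearMap.sub_comp, LinearMap.comp_assoc, hdd,
      LinearMap.comp_zero, sub_zero])
  refine ⟨h, ?_, hrel⟩
  rw [(hgood 0).2 rfl]
  exact hh₀

/-- `Tor_i(S/I, k)` has a nonzero element of degree `j`, computed from the resolution `P`. -/
def TorNonzero (P : GradedFreeResolution I) (i j : ℕ) : Prop :=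
  ∃ z : P.idx i → k, (∀ e, P.shift i e ≠ j → z e = 0) ∧
    (∀ i' (h : i = i' + 1), reduceMap (P.d i') (h ▸ z) = 0) ∧
    ¬ ∃ y, reduceMap (P.d i) y = z

/-- Comparison maps run both ways and `ψ ∘ φ` is homotopic to the identity. If the image of `z` were
a boundary, so would be `z`. -/
lemma TorNonzero.of_resolution (hI : ∀ p ∈ I, ∀ n, MvPolynomial.homogeneousComponent n p ∈ I)
    {P : GradedFreeResolution I} {i j : ℕ} (h : P.TorNonzero i j) (Q : GradedFreeResolution I) :
    Q.TorNonzero i j := by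
  obtain ⟨z, hz, hz0, hzb⟩ := h
  obtain ⟨φ, hφ, hφa, hφd⟩ := exists_chainMap hI P Q
  obtain ⟨ψ, hψ, hψa, hψd⟩ := exists_chainMap hI Q P
  obtain ⟨h, hh₀, hh⟩ := P.exists_homotopy (fun i => ψ i ∘ₗ φ i - LinearMap.id)
    (by rw [LinearMap.comp_sub, ← LinearMap.comp_assoc, hψa, hφa, LinearMap.comp_id, sub_self])
    (fun i => by
      rw [LinearMap.comp_sub, LinearMap.sub_comp, ← LinearMap.comp_assoc, hψd, LinearMap.comp_assoc,
        hφd, LinearMap.comp_assoc, LinearMap.comp_id, LinearMap.id_comp])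
  refine ⟨reduceMap (φ i) z, fun e he => (hφ i).reduceMap_apply_eq_zero hz he, ?_, ?_⟩
  · rintro i' rfl
    have := hz0 i' rfl
    dsimp only at this ⊢
    rw [← LinearMap.comp_apply, ← reduceMap_comp, hφd, reduceMap_comp, LinearMap.comp_apply, this,
      map_zero]
  · rintro ⟨y, hy⟩
    have hψφ : reduceMap (ψ i ∘ₗ φ i) z = reduceMap (P.d i) (reduceMap (ψ (i + 1)) y) := by
      rw [reduceMap_comp, LinearMap.comp_apply, ← hy, ← LinearMap.comp_apply, ← reduceMap_comp,
        ← hψd, reduceMap_comp, LinearMap.comp_apply]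
    have hθ : reduceMap (ψ i ∘ₗ φ i - LinearMap.id) z = reduceMap (P.d i) (reduceMap (h i) z) := by
      rcases i with _ | i
      · rw [← hh₀, reduceMap_comp, LinearMap.comp_apply]
      · rw [← hh i, reduceMap_add, reduceMap_comp, reduceMap_comp, LinearMap.add_apply,
          LinearMap.comp_apply, LinearMap.comp_apply, show reduceMap (P.d i) z = 0 from hz0 i rfl,
          map_zero, add_zero]
    rw [reduceMap_sub, LinearMap.sub_apply, reduceMap_id, hψφ, LinearMap.id_apply] at hθ
    refine hzb ⟨reduceMap (ψ (i + 1)) y - reduceMap (h i) z, ?_⟩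
    rw [map_sub, ← hθ, sub_sub_cancel]

end GradedFreeResolution

/-! ### Betti numbers of a minimal resolution as Tor -/

namespace MinimalGradedFreeResolution

variable {σ k : Type*} [Field k] {I : Ideal (MvPolynomial σ k)}

/-- A minimal resolution as a graded free resolution. -/
def toGradedFreeResolution (R : MinimalGradedFreeResolution I) : GradedFreeResolution I where
  idx i := Fin (R.rank i)
  shift := R.shift
  d := R.d
  aug := R.aug
  aug_surjective := R.aug_surjective
  exact_zero := R.exact_zero
  exact_succ := R.exact_succ
  aug_graded := R.aug_graded
  d_graded := R.d_graded

lemma betti_ne_zero_iff_exists (R : MinimalGradedFreeResolution I) (i j : ℕ) :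
    R.betti i j ≠ 0 ↔ ∃ e, R.shift i e = j := by
  rw [betti, Finset.card_ne_zero]
  simp [Finset.Nonempty]

lemma constantCoeff_eq_zero_of_mem_idealOfVars {p : MvPolynomial σ k}
    (hp : p ∈ MvPolynomial.idealOfVars σ k) : MvPolynomial.constantCoeff p = 0 := by
  have h : MvPolynomial.idealOfVars σ k ≤ RingHom.ker (MvPolynomial.constantCoeff (R := k)) := by
    rw [MvPolynomial.idealOfVars, Ideal.span_le]
    rintro _ ⟨i, rfl⟩
    simp
  exact h hp

lemma reduceMap_d (R : MinimalGradedFreeResolution I) (i : ℕ) : reduceMap (R.d i) = 0 := by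
  refine LinearMap.ext fun x => funext fun e' => ?_
  rw [reduceMap_apply]
  refine Finset.sum_eq_zero fun e _ => ?_
  have h : R.d i (Pi.single e 1) ∈ MvPolynomial.idealOfVars σ k • (⊤ : Submodule _ _) :=
    R.minimal i ⟨_, rfl⟩
  have h2 : R.d i (Pi.single e 1) e' ∈ MvPolynomial.idealOfVars σ k := by
    refine Submodule.smul_induction_on h (fun r hr x _ => ?_) fun x y hx hy => ?_
    · exact Ideal.mul_mem_right _ _ hr
    · exact add_mem hx hy
  rw [constantCoeff_eq_zero_of_mem_idealOfVars h2, zero_mul]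

/-- By minimality all reduced differentials vanish, so each basis element gives a nonzero class. -/
lemma betti_ne_zero_iff_torNonzero (R : MinimalGradedFreeResolution I) (i j : ℕ) :
    R.betti i j ≠ 0 ↔ R.toGradedFreeResolution.TorNonzero i j := by
  rw [betti_ne_zero_iff_exists]
  constructor
  · rintro ⟨e, he⟩
    refine ⟨(Pi.single e 1 : Fin (R.rank i) → k), fun e' he' => ?_, ?_, ?_⟩
    · refine Pi.single_eq_of_ne ?_ _
      rintro rfl
      exact he' he
    · rintro i' rfl
      exact LinearMap.congr_fun (R.reduceMap_d i') _
    · rintro ⟨y, hy⟩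
      have h1 : (0 : Fin (R.rank i) → k) = Pi.single e 1 :=
        (LinearMap.congr_fun (R.reduceMap_d i) y).symm.trans hy
      simpa using congrFun h1 e
  · rintro ⟨z, hz, -, hzb⟩
    by_contra! hno
    refine hzb ⟨0, ?_⟩
    rw [map_zero]
    exact funext fun e => (hz e (hno e)).symm

end MinimalGradedFreeResolution

/-! ### Splitting chains by the size of faces -/

section CardinalityGrading

variable {ι R : Type*} [CommRing R]

/-- The restriction of a chain to the faces with `i` elements. -/
def restrictCard (ι R : Type*) [CommRing R] (i : ℕ) :
    (Finset ι → R) →ₗ[R] ({A : Finset ι // #A = i} → R) :=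
  LinearMap.funLeft R R Subtype.val

/-- A chain on faces with `i` elements, extended by zero. -/
def extendCard (ι R : Type*) [CommRing R] (i : ℕ) :
    ({A : Finset ι // #A = i} → R) →ₗ[R] (Finset ι → R) where
  toFun c A := if h : #A = i then c ⟨A, h⟩ else 0
  map_add' c c' := by ext A; by_cases h : #A = i <;> simp [h]
  map_smul' r c := by ext A; by_cases h : #A = i <;> simp [h]

lemma restrictCard_apply {i : ℕ} (c : Finset ι → R) (A : {A : Finset ι // #A = i}) :
    restrictCard ι R i c A = c A.1 := rfl

lemma extendCard_of_card_eq {i : ℕ} (c : {A : Finset ι // #A = i} → R) {A : Finset ι}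
    (h : #A = i) : extendCard ι R i c A = c ⟨A, h⟩ := dif_pos h

lemma extendCard_of_card_ne {i : ℕ} (c : {A : Finset ι // #A = i} → R) {A : Finset ι}
    (h : #A ≠ i) : extendCard ι R i c A = 0 := dif_neg h

lemma restrictCard_extendCard {i : ℕ} (c : {A : Finset ι // #A = i} → R) :
    restrictCard ι R i (extendCard ι R i c) = c := by
  ext A
  rw [restrictCard_apply, extendCard_of_card_eq c A.2]

lemma extendCard_restrictCard {i : ℕ} {c : Finset ι → R} (hc : ∀ A, c A ≠ 0 → #A = i) :
    extendCard ι R i (restrictCard ι R i c) = c := by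
  ext A
  by_cases h : #A = i
  · rw [extendCard_of_card_eq _ h, restrictCard_apply]
  · rw [extendCard_of_card_ne _ h]
    by_contra h'
    exact h (hc A (Ne.symm h'))

variable [LinearOrder ι] [Fintype ι] (w : Finset ι → ι → R)

lemma extendCard_restrictCard_weightedBoundary {i : ℕ} (c : {A : Finset ι // #A = i + 1} → R) :
    extendCard ι R i (restrictCard ι R i (weightedBoundary w (extendCard ι R (i + 1) c))) =
      weightedBoundary w (extendCard ι R (i + 1) c) := by
  refine extendCard_restrictCard fun B hB => ?_
  by_contra h
  refine hB ?_
  rw [weightedBoundary_apply]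
  refine sum_eq_zero fun j hj => ?_
  rw [extendCard_of_card_ne, mul_zero]
  rw [card_insert_of_notMem (mem_compl.1 hj)]
  omega

lemma restrictCard_weightedBoundary_extendCard {i : ℕ} (c : Finset ι → R) :
    restrictCard ι R i (weightedBoundary w (extendCard ι R (i + 1) (restrictCard ι R (i + 1) c))) =
      restrictCard ι R i (weightedBoundary w c) := by
  ext B
  rw [restrictCard_apply, restrictCard_apply, weightedBoundary_apply, weightedBoundary_apply]
  refine sum_congr rfl fun j hj => ?_
  rw [extendCard_of_card_eq, restrictCard_apply]
  rw [card_insert_of_notMem (mem_compl.1 hj), B.2]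

lemma weightedBoundary_extendCard_zero (c : {A : Finset ι // #A = 0} → R) :
    weightedBoundary w (extendCard ι R 0 c) = 0 := by
  ext B
  rw [weightedBoundary_apply]
  refine sum_eq_zero fun j hj => ?_
  rw [extendCard_of_card_ne, mul_zero]
  rw [card_insert_of_notMem (mem_compl.1 hj)]
  omega

end CardinalityGrading

/-! ### Exactness of the Taylor complex -/

section Taylor

variable {ι σ k : Type*} [DecidableEq σ] [Field k]

/-- The exponent of the squarefree monomial with support `T`. -/
noncomputable def squarefreeExponent (T : Finset σ) : σ →₀ ℕ := ∑ x ∈ T, Finsupp.single x 1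

lemma squarefreeExponent_apply (T : Finset σ) (x : σ) :
    squarefreeExponent T x = if x ∈ T then 1 else 0 := by
  simp [squarefreeExponent, Finsupp.single_apply]

lemma prod_X_eq_monomial {σ k : Type*} [Field k] (T : Finset σ) :
    ∏ x ∈ T, (MvPolynomial.X x : MvPolynomial σ k) =
      MvPolynomial.monomial (squarefreeExponent T) 1 := by
  rw [squarefreeExponent, MvPolynomial.monomial_sum_one]
  rfl

lemma squarefreeExponent_le_iff {T : Finset σ} {u : σ →₀ ℕ} :
    squarefreeExponent T ≤ u ↔ T ⊆ u.support := by
  rw [Finsupp.le_def]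
  constructor
  · intro h x hx
    have := h x
    rw [squarefreeExponent_apply, if_pos hx] at this
    rw [Finsupp.mem_support_iff]
    omega
  · intro h x
    rw [squarefreeExponent_apply]
    split_ifs with hx
    · exact Nat.one_le_iff_ne_zero.2 (Finsupp.mem_support_iff.1 (h hx))
    · exact Nat.zero_le _

/-- The weights of the Taylor complex. -/
noncomputable def taylorWeight (k : Type*) [Field k] (f : ι → Finset σ) (B : Finset ι) (i : ι) :
    MvPolynomial σ k :=
  ∏ x ∈ f i \ B.biUnion f, MvPolynomial.X x

variable [LinearOrder ι] {f : ι → Finset σ}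

lemma constantCoeff_taylorWeight {ι : Type*} {f : ι → Finset σ} (B : Finset ι) (i : ι) :
    MvPolynomial.constantCoeff (taylorWeight k f B i) = reducedWeight k f B i := by
  rw [taylorWeight, reducedWeight, map_prod]
  split_ifs with h
  · rw [sdiff_eq_empty_iff_subset.2 h, prod_empty]
  · obtain ⟨x, hx⟩ := sdiff_nonempty.2 h
    exact prod_eq_zero hx (by simp)

lemma squarefreeExponent_add_sub {B : Finset ι} {i : ι} {u : σ →₀ ℕ}
    (h : (insert i B).biUnion f ⊆ u.support) :
    squarefreeExponent (f i \ B.biUnion f) + (u - squarefreeExponent ((insert i B).biUnion f)) =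
      u - squarefreeExponent (B.biUnion f) := by
  ext x
  have hx : x ∈ (insert i B).biUnion f → u x ≠ 0 := fun hx => Finsupp.mem_support_iff.1 (h hx)
  rw [biUnion_insert] at *
  simp only [Finsupp.add_apply, Finsupp.tsub_apply, squarefreeExponent_apply, mem_sdiff,
    mem_union] at *
  by_cases h1 : x ∈ f i <;> by_cases h2 : x ∈ B.biUnion f <;> (simp [h1, h2] at *; try omega)

lemma faceSign_eq_C {σ : Type*} (i : ι) (B : Finset ι) :
    faceSign (MvPolynomial σ k) i B = MvPolynomial.C (faceSign k i B) := by
  simp [faceSign]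

/-- The element of multidegree `u` of the Taylor complex with coefficients `b`. -/
noncomputable def ofMultidegree {ι : Type*} (f : ι → Finset σ) (u : σ →₀ ℕ) (b : Finset ι → k) :
    Finset ι → MvPolynomial σ k :=
  fun A => MvPolynomial.monomial (u - squarefreeExponent (A.biUnion f)) (b A)

/-- The coefficients of the part of multidegree `u` of an element of the Taylor complex. -/
noncomputable def multidegreePart {ι : Type*} (f : ι → Finset σ) (u : σ →₀ ℕ)
    (c : Finset ι → MvPolynomial σ k) : Finset ι → k :=
  fun A => if A.biUnion f ⊆ u.support then
    (c A).coeff (u - squarefreeExponent (A.biUnion f)) else 0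

lemma taylorWeight_mul_comm (B : Finset ι) (i j : ι) :
    taylorWeight k f B i * taylorWeight k f (insert i B) j =
      taylorWeight k f B j * taylorWeight k f (insert j B) i := by
  have key : ∀ i j : ι, taylorWeight k f B i * taylorWeight k f (insert i B) j =
      ∏ x ∈ (f i ∪ f j) \ B.biUnion f, MvPolynomial.X x := fun i j => by
    rw [taylorWeight, taylorWeight, biUnion_insert, ← prod_union]
    · congr 1
      ext x
      simp only [mem_union, mem_sdiff]
      tauto
    · rw [disjoint_left]
      intro x
      simp only [mem_union, mem_sdiff]
      tauto
  rw [key, key, union_comm]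

variable [Fintype ι]

/-- In a fixed multidegree the monomial factors are forced, leaving the plain boundary of a simplex
over `k`. The constant empty family makes all reduced weights equal to 1. -/
lemma weightedBoundary_ofMultidegree {u : σ →₀ ℕ} {b : Finset ι → k}
    (hb : ∀ A, b A ≠ 0 → A.biUnion f ⊆ u.support) :
    weightedBoundary (taylorWeight k f) (ofMultidegree f u b) =
      ofMultidegree f u (reducedBoundary k (fun _ : ι => (∅ : Finset σ)) b) := by
  ext1 B
  rw [weightedBoundary_apply, ofMultidegree, reducedBoundary_apply, map_sum]
  refine sum_congr rfl fun i _ => ?_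
  rw [if_pos (empty_subset _), mul_one, ofMultidegree]
  by_cases h : b (insert i B) = 0
  · simp [h]
  · rw [faceSign_eq_C, taylorWeight, prod_X_eq_monomial, mul_assoc, MvPolynomial.monomial_mul,
      squarefreeExponent_add_sub (hb _ h), one_mul, MvPolynomial.C_mul_monomial]

lemma multidegreePart_weightedBoundary (u : σ →₀ ℕ) (c : Finset ι → MvPolynomial σ k) :
    multidegreePart f u (weightedBoundary (taylorWeight k f) c) =
      reducedBoundary k (fun _ : ι => (∅ : Finset σ)) (multidegreePart f u c) := by
  ext1 B
  rw [reducedBoundary_apply, multidegreePart]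
  by_cases hB : B.biUnion f ⊆ u.support
  · rw [if_pos hB, weightedBoundary_apply, MvPolynomial.coeff_sum]
    refine sum_congr rfl fun i _ => ?_
    rw [if_pos (empty_subset _), mul_one, multidegreePart, faceSign_eq_C, mul_assoc,
      MvPolynomial.coeff_C_mul, taylorWeight, prod_X_eq_monomial, MvPolynomial.coeff_monomial_mul']
    by_cases h : (insert i B).biUnion f ⊆ u.support
    · have h1 := squarefreeExponent_add_sub h
      rw [if_pos h, one_mul, if_pos (h1 ▸ le_self_add), ← h1, add_tsub_cancel_left]
    · rw [if_neg h, if_neg]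
      intro h2
      refine h ?_
      rw [biUnion_insert]
      refine union_subset (fun x hx => ?_) hB
      by_cases hxB : x ∈ B.biUnion f
      · exact hB hxB
      · exact squarefreeExponent_le_iff.1 (h2.trans tsub_le_self) (mem_sdiff.2 ⟨hx, hxB⟩)
  · rw [if_neg hB]
    refine (sum_eq_zero fun i _ => ?_).symm
    rw [multidegreePart, if_neg (c := (insert i B).biUnion f ⊆ u.support), mul_zero]
    intro h
    rw [biUnion_insert] at h
    exact hB (subset_union_right.trans h)

lemma exists_eq_sum_ofMultidegree {ι : Type*} [Fintype ι] {f : ι → Finset σ}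
    (c : Finset ι → MvPolynomial σ k) :
    ∃ M : Finset (σ →₀ ℕ), c = ∑ u ∈ M, ofMultidegree f u (multidegreePart f u c) := by
  refine ⟨univ.biUnion fun A : Finset ι =>
    (c A).support.image fun w => w + squarefreeExponent (A.biUnion f), ?_⟩
  ext A w
  rw [Finset.sum_apply, MvPolynomial.coeff_sum]
  set u₀ := w + squarefreeExponent (A.biUnion f) with hu₀
  have hval : (ofMultidegree f u₀ (multidegreePart f u₀ c) A).coeff w = (c A).coeff w := by
    rw [ofMultidegree, multidegreePart, if_pos (squarefreeExponent_le_iff.1 (hu₀ ▸ le_add_self)),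
      hu₀, add_tsub_cancel_right, MvPolynomial.coeff_monomial, if_pos rfl]
  rw [sum_eq_single u₀, hval]
  · intro u _ hu
    rw [ofMultidegree, multidegreePart]
    split_ifs with h
    · rw [MvPolynomial.coeff_monomial, if_neg]
      intro h1
      exact hu (by rw [hu₀, ← h1, tsub_add_cancel_of_le (squarefreeExponent_le_iff.2 h)])
    · simp
  · intro h
    rw [hval]
    by_contra h0
    exact h (mem_biUnion.2 ⟨A, mem_univ _, mem_image.2 ⟨w, MvPolynomial.mem_support_iff.2 h0, rfl⟩⟩)

/-- The ideal generated by the squarefree monomials with supports `f i`. -/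
noncomputable def squarefreeIdeal {ι σ : Type*} (k : Type*) [Field k] (f : ι → Finset σ) :
    Ideal (MvPolynomial σ k) :=
  Ideal.span (Set.range fun i => ∏ x ∈ f i, MvPolynomial.X x)

lemma exists_subset_support_of_mem_squarefreeIdeal {ι : Type*} {f : ι → Finset σ}
    {p : MvPolynomial σ k} (hp : p ∈ squarefreeIdeal k f) {u : σ →₀ ℕ} (hu : p.coeff u ≠ 0) :
    ∃ i, f i ⊆ u.support := by
  have h : squarefreeIdeal k f = Ideal.span ((fun s => MvPolynomial.monomial s (1 : k)) ''
      Set.range fun i => squarefreeExponent (f i)) := by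
    rw [squarefreeIdeal, ← Set.range_comp]
    congr 2
    ext1 i
    exact prod_X_eq_monomial _
  rw [h, MvPolynomial.mem_ideal_span_monomial_image] at hp
  obtain ⟨_, ⟨i, rfl⟩, hi⟩ := hp u (MvPolynomial.mem_support_iff.2 hu)
  exact ⟨i, squarefreeExponent_le_iff.1 hi⟩

/-- Exactness of the Taylor complex. -/
lemma exists_weightedBoundary_taylorWeight_eq {c : Finset ι → MvPolynomial σ k}
    (hc : weightedBoundary (taylorWeight k f) c = 0) (hc0 : c ∅ ∈ squarefreeIdeal k f) :
    ∃ b, weightedBoundary (taylorWeight k f) b = c := by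
  have hex : ∀ u, ∃ b, weightedBoundary (taylorWeight k f) b =
      ofMultidegree f u (multidegreePart f u c) := fun u => by
    by_cases h0 : multidegreePart f u c = 0
    · refine ⟨0, ?_⟩
      rw [h0, map_zero]
      ext1 A
      exact (map_zero _).symm
    · obtain ⟨A, hA⟩ := Function.ne_iff.1 h0
      have hsupp : ∀ A, multidegreePart f u c A ≠ 0 → A.biUnion f ⊆ u.support := fun A hA => by
        by_contra h
        exact hA (if_neg h)
      -- The cone needs an apex whose monomial divides that of `u`. Any vertex of `A` serves; if `A`
      -- is empty, membership in the ideal supplies one.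
      obtain ⟨i, hi⟩ : ∃ i, f i ⊆ u.support := by
        rcases A.eq_empty_or_nonempty with rfl | ⟨i, hi⟩
        · refine exists_subset_support_of_mem_squarefreeIdeal hc0 (u := u) ?_
          rw [multidegreePart, if_pos (hsupp _ hA)] at hA
          simpa [squarefreeExponent] using hA
        · exact ⟨i, (subset_biUnion_of_mem f hi).trans (hsupp A hA)⟩
      refine ⟨ofMultidegree f u (coneMap k i (multidegreePart f u c)), ?_⟩
      rw [weightedBoundary_ofMultidegree, reducedBoundary_coneMap_eq_self
        (f := fun _ : ι => (∅ : Finset σ)) rfl]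
      · rw [← multidegreePart_weightedBoundary, hc]
        ext A
        simp [multidegreePart]
      · intro A hA
        obtain ⟨h1, h2⟩ := exists_of_coneMap_ne_zero hA
        rw [← insert_erase h1, biUnion_insert]
        exact union_subset hi (hsupp _ h2)
  choose b hb using hex
  obtain ⟨M, hM⟩ := exists_eq_sum_ofMultidegree (f := f) c
  exact ⟨∑ u ∈ M, b u, by rw [map_sum, sum_congr rfl fun u _ => hb u, ← hM]⟩

end Taylor

/-! ### The Taylor resolution and Betti numbers -/

section TaylorResolution

variable {ι : Type} {σ k : Type*} [DecidableEq σ] [Field k] [LinearOrder ι] [Fintype ι]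

/-- The differential of the Taylor complex. -/
noncomputable def taylorDifferential (k : Type*) [Field k] (f : ι → Finset σ) (i : ℕ) :
    ({A : Finset ι // #A = i + 1} → MvPolynomial σ k) →ₗ[MvPolynomial σ k]
      ({A : Finset ι // #A = i} → MvPolynomial σ k) :=
  restrictCard ι _ i ∘ₗ weightedBoundary (taylorWeight k f) ∘ₗ extendCard ι _ (i + 1)

lemma taylorDifferential_apply (f : ι → Finset σ) (i : ℕ)
    (c : {A : Finset ι // #A = i + 1} → MvPolynomial σ k) :
    taylorDifferential k f i c =
      restrictCard ι _ i (weightedBoundary (taylorWeight k f) (extendCard ι _ (i + 1) c)) := rfl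

/-- The augmentation of the Taylor complex. -/
noncomputable def taylorAugmentation {ι σ : Type*} (k : Type*) [Field k] (f : ι → Finset σ) :
    ({A : Finset ι // #A = 0} → MvPolynomial σ k) →ₗ[MvPolynomial σ k]
      (MvPolynomial σ k ⧸ squarefreeIdeal k f) :=
  (Ideal.Quotient.mkₐ (MvPolynomial σ k) (squarefreeIdeal k f)).toLinearMap ∘ₗ
    LinearMap.proj ⟨∅, card_empty⟩

lemma taylorAugmentation_apply {ι σ : Type*} (f : ι → Finset σ)
    (c : {A : Finset ι // #A = 0} → MvPolynomial σ k) :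
    taylorAugmentation k f c = Ideal.Quotient.mk (squarefreeIdeal k f) (c ⟨∅, card_empty⟩) := rfl

lemma taylorDifferential_isGradedMap (f : ι → Finset σ) (i : ℕ) :
    IsGradedMap (fun A : {A : Finset ι // #A = i + 1} => #(A.1.biUnion f))
      (fun A : {A : Finset ι // #A = i} => #(A.1.biUnion f)) (taylorDifferential k f i) := by
  intro A B
  rw [taylorDifferential_apply, restrictCard_apply, weightedBoundary_apply]
  have hext : ∀ A' : Finset ι, extendCard ι (MvPolynomial σ k) (i + 1) (Pi.single A 1) A' =
      if A' = A.1 then 1 else 0 := fun A' => by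
    by_cases h : #A' = i + 1
    · rw [extendCard_of_card_eq _ h, Pi.single_apply]
      simp only [Subtype.ext_iff]
    · rw [extendCard_of_card_ne _ h, if_neg]
      rintro rfl
      exact h A.2
  simp only [hext]
  by_cases hex : ∃ j ∉ B.1, insert j B.1 = A.1
  · obtain ⟨j, hj, hjA⟩ := hex
    right
    refine ⟨#(f j \ B.1.biUnion f), ?_, ?_⟩
    · rw [← hjA, biUnion_insert, union_comm, ← card_union_of_disjoint disjoint_sdiff,
        union_sdiff_self_eq_union]
    · rw [sum_eq_single_of_mem j (mem_compl.2 hj), if_pos hjA, mul_one, faceSign_eq_C, taylorWeight]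
      · have h1 : (∏ x ∈ f j \ B.1.biUnion f, (MvPolynomial.X x : MvPolynomial σ k)).IsHomogeneous
            (∑ _x ∈ f j \ B.1.biUnion f, 1) :=
          MvPolynomial.IsHomogeneous.prod _ _ _ fun x _ => MvPolynomial.isHomogeneous_X k x
        rw [← card_eq_sum_ones] at h1
        simpa using (MvPolynomial.isHomogeneous_C σ (faceSign k j B.1)).mul h1
      · intro j' hj' hne
        rw [if_neg, mul_zero]
        intro h
        have : j' ∈ insert j B.1 := by
          rw [hjA, ← h]; exact mem_insert_self _ _
        exact mem_compl.1 hj' ((mem_insert.1 this).resolve_left hne)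
  · left
    refine sum_eq_zero fun j hj => ?_
    rw [if_neg, mul_zero]
    intro h
    exact hex ⟨j, mem_compl.1 hj, h⟩

lemma taylorDifferential_exact_zero (f : ι → Finset σ) :
    Function.Exact (taylorDifferential k f 0) (taylorAugmentation k f) := by
  intro c
  rw [taylorAugmentation_apply, Ideal.Quotient.eq_zero_iff_mem]
  constructor
  · intro hc
    obtain ⟨b, hb⟩ := exists_weightedBoundary_taylorWeight_eq (f := f)
      (weightedBoundary_extendCard_zero _ c) (by rwa [extendCard_of_card_eq c card_empty])
    refine ⟨restrictCard ι _ 1 b, ?_⟩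
    rw [taylorDifferential_apply, restrictCard_weightedBoundary_extendCard, hb,
      restrictCard_extendCard]
  · rintro ⟨b, rfl⟩
    rw [taylorDifferential_apply, restrictCard_apply, weightedBoundary_apply]
    refine sum_mem fun i _ => Ideal.mul_mem_right _ _ (Ideal.mul_mem_left _ _ ?_)
    rw [taylorWeight, biUnion_empty, sdiff_empty]
    exact Ideal.subset_span ⟨i, rfl⟩

lemma taylorDifferential_exact_succ (f : ι → Finset σ) (i : ℕ) :
    Function.Exact (taylorDifferential k f (i + 1)) (taylorDifferential k f i) := by
  intro c
  constructor
  · intro hc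
    obtain ⟨b, hb⟩ := exists_weightedBoundary_taylorWeight_eq (f := f)
      (c := extendCard ι _ (i + 1) c) (by
        rw [← extendCard_restrictCard_weightedBoundary, ← taylorDifferential_apply, hc, map_zero])
      -- The chain lives on faces of size `i + 1`, so its value at the empty face is zero and the
      -- ideal condition is void.
      (by rw [extendCard_of_card_ne c (by simp)]; exact zero_mem _)
    refine ⟨restrictCard ι _ (i + 2) b, ?_⟩
    rw [taylorDifferential_apply, restrictCard_weightedBoundary_extendCard, hb,
      restrictCard_extendCard]
  · rintro ⟨b, rfl⟩
    rw [taylorDifferential_apply, taylorDifferential_apply,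
      extendCard_restrictCard_weightedBoundary,
      weightedBoundary_weightedBoundary taylorWeight_mul_comm, map_zero]

/-- The Taylor resolution of the ideal generated by squarefree monomials. -/
noncomputable def taylorResolution (k : Type*) [Field k] (f : ι → Finset σ) :
    GradedFreeResolution (squarefreeIdeal k f) where
  idx i := {A : Finset ι // #A = i}
  shift i A := #(A.1.biUnion f)
  d := taylorDifferential k f
  aug := taylorAugmentation k f
  aug_surjective y := by
    obtain ⟨p, rfl⟩ := Ideal.Quotient.mk_surjective y
    exact ⟨fun _ => p, rfl⟩
  exact_zero := taylorDifferential_exact_zero f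
  exact_succ := taylorDifferential_exact_succ f
  aug_graded := by
    rintro ⟨A, hA⟩
    obtain rfl := card_eq_zero.1 hA
    refine ⟨1, by simpa using MvPolynomial.isHomogeneous_one σ k, ?_⟩
    rw [taylorAugmentation_apply, Pi.single_eq_same]
  d_graded := taylorDifferential_isGradedMap f

lemma reduceMap_apply_eq_constantCoeff {σ ι κ : Type*} [Fintype ι] [DecidableEq ι]
    (φ : (ι → MvPolynomial σ k) →ₗ[MvPolynomial σ k] (κ → MvPolynomial σ k)) (x : ι → k) (e' : κ) :
    reduceMap φ x e' = MvPolynomial.constantCoeff (φ (fun e => MvPolynomial.C (x e)) e') := by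
  rw [reduceMap_apply, linearMap_apply_eq_sum, map_sum]
  refine sum_congr rfl fun e _ => ?_
  rw [map_mul, MvPolynomial.constantCoeff_C, mul_comm]

lemma reduceMap_taylorDifferential (f : ι → Finset σ) (i : ℕ)
    (x : {A : Finset ι // #A = i + 1} → k) :
    reduceMap (taylorDifferential k f i) x =
      restrictCard ι k i (reducedBoundary k f (extendCard ι k (i + 1) x)) := by
  ext B
  rw [reduceMap_apply_eq_constantCoeff, taylorDifferential_apply, restrictCard_apply,
    restrictCard_apply, weightedBoundary_apply, reducedBoundary, weightedBoundary_apply, map_sum]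
  refine sum_congr rfl fun j hj => ?_
  have hcard : #(insert j B.1) = i + 1 := by
    rw [card_insert_of_notMem (mem_compl.1 hj), B.2]
  rw [map_mul, map_mul, constantCoeff_taylorWeight, extendCard_of_card_eq _ hcard,
    extendCard_of_card_eq _ hcard, faceSign_eq_C, MvPolynomial.constantCoeff_C,
    MvPolynomial.constantCoeff_C]

/-- The degree-`j` part is the sum of the multidegrees with `j` elements; if all of these had
vanishing homology, the cycle would be a boundary. -/
lemma taylorResolution_torNonzero_iff (f : ι → Finset σ) (i j : ℕ) :
    (taylorResolution k f).TorNonzero i j ↔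
      ∃ m : Finset σ, #m = j ∧ TaylorHomologyNonzero k univ f i m := by
  constructor
  · rintro ⟨(z : {A : Finset ι // #A = i} → k), hz, hz0, hzb⟩
    by_contra! hno
    obtain ⟨b, -, hb⟩ := exists_reducedBoundary_eq_of_forall_not (k := k) (f := f) (s := univ)
      (p := i) {m | #m = j} hno (c := extendCard ι k i z) (fun A hA => by
        have hcard : #A = i := by
          by_contra h
          exact hA (extendCard_of_card_ne z h)
        refine ⟨subset_univ _, hcard, ?_⟩
        rw [extendCard_of_card_eq z hcard] at hA
        by_contra h
        exact hA (hz ⟨A, hcard⟩ h)) (by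
        rcases i with _ | i
        · exact weightedBoundary_extendCard_zero _ z
        · have h1 : reduceMap (taylorDifferential k f i) z = 0 := hz0 i rfl
          rw [reduceMap_taylorDifferential] at h1
          have h2 := extendCard_restrictCard_weightedBoundary (reducedWeight k f) z
          rw [← reducedBoundary, h1, map_zero] at h2
          exact h2.symm)
    refine hzb ⟨restrictCard ι k (i + 1) b, ?_⟩
    change reduceMap (taylorDifferential k f i) _ = z
    rw [reduceMap_taylorDifferential, reducedBoundary, restrictCard_weightedBoundary_extendCard,
      ← reducedBoundary, hb, restrictCard_extendCard]
  · rintro ⟨m, hm, c, hc, hc0, hcb⟩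
    have hext : extendCard ι k i (restrictCard ι k i c) = c :=
      extendCard_restrictCard fun A hA => (hc A hA).2.1
    refine ⟨restrictCard ι k i c, fun A hA => ?_, ?_, ?_⟩
    · by_contra h
      refine hA ?_
      rw [← hm, ← (hc A.1 h).2.2]
      rfl
    · rintro i' rfl
      change reduceMap (taylorDifferential k f i') (restrictCard ι k (i' + 1) c) = 0
      rw [reduceMap_taylorDifferential, hext, hc0, map_zero]
    · rintro ⟨(y : {A : Finset ι // #A = i + 1} → k), hy⟩
      change reduceMap (taylorDifferential k f i) y = _ at hy
      refine hcb ⟨extendCard ι k (i + 1) y, fun _ _ => subset_univ _, ?_⟩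
      rw [reduceMap_taylorDifferential] at hy
      have h2 := extendCard_restrictCard_weightedBoundary (reducedWeight k f) y
      rw [← reducedBoundary, hy, hext] at h2
      exact h2.symm

lemma homogeneousComponent_mem_squarefreeIdeal {σ ι : Type*} (f : ι → Finset σ)
    (p : MvPolynomial σ k) (hp : p ∈ squarefreeIdeal k f) (n : ℕ) :
    MvPolynomial.homogeneousComponent n p ∈ squarefreeIdeal k f := by
  let := MvPolynomial.gradedAlgebra (σ := σ) (R := k)
  refine MvPolynomial.homogeneousComponent_mem_of_mem (Ideal.homogeneous_span _ _ ?_) hp n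
  rintro _ ⟨i, rfl⟩
  exact ⟨_, MvPolynomial.IsHomogeneous.prod _ _ _ fun x _ => MvPolynomial.isHomogeneous_X k x⟩

lemma MinimalGradedFreeResolution.betti_ne_zero_iff_taylorHomologyNonzero {f : ι → Finset σ}
    (R : MinimalGradedFreeResolution (squarefreeIdeal k f)) (i j : ℕ) :
    R.betti i j ≠ 0 ↔ ∃ m : Finset σ, #m = j ∧ TaylorHomologyNonzero k univ f i m := by
  have hI := homogeneousComponent_mem_squarefreeIdeal (k := k) f
  rw [R.betti_ne_zero_iff_torNonzero, ← taylorResolution_torNonzero_iff]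
  exact ⟨fun h => h.of_resolution hI _, fun h => h.of_resolution hI _⟩

end TaylorResolution

/-! ### Vanishing ranks bound the projective dimension -/

section ProjectiveDimension

open CategoryTheory

universe u

lemma hasProjectiveDimensionLT_succ_of_surjective {R : Type u} [CommRing R] {M N : Type u}
    [AddCommGroup M] [Module R M] [AddCommGroup N] [Module R N] [Module.Projective R M]
    {g : M →ₗ[R] N} (hg : Function.Surjective g) {n : ℕ}
    (h : HasProjectiveDimensionLT (ModuleCat.of R (LinearMap.ker g)) n) :
    HasProjectiveDimensionLT (ModuleCat.of R N) (n + 1) := by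
  have : Projective (ModuleCat.of R M) :=
    (IsProjective.iff_projective M).1 inferInstance
  refine (LinearMap.shortExact_shortComplexKer hg).hasProjectiveDimensionLT_X₃ n h ?_
  exact hasProjectiveDimensionLT_of_ge _ 1 _ (by omega)

namespace MinimalGradedFreeResolution

variable {σ k : Type*} [Field k] {I : Ideal (MvPolynomial σ k)}

/-- Dimension shifting: the kernel of the map from the free module onto the image of `d i` is the
image of `d (i + 1)`. The recursion ends at an image of the zero module. -/
lemma hasProjectiveDimensionLT_range_d (R : MinimalGradedFreeResolution I) {j : ℕ} :
    ∀ {i : ℕ}, R.rank (i + j + 1) = 0 →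
      HasProjectiveDimensionLT (ModuleCat.of (MvPolynomial σ k) (LinearMap.range (R.d i))) j := by
  induction j with
  | zero =>
    intro i h
    have : IsEmpty (Fin (R.rank (i + 1))) := by
      rw [add_zero] at h
      rw [h]
      infer_instance
    have : Subsingleton (LinearMap.range (R.d i)) := by
      refine ⟨?_⟩
      rintro ⟨_, x, rfl⟩ ⟨_, y, rfl⟩
      rw [Subsingleton.elim x y]
    exact (ModuleCat.isZero_of_subsingleton _).hasProjectiveDimensionLT_zero
  | succ j ih =>
    intro i h
    refine hasProjectiveDimensionLT_succ_of_surjective (R.d i).surjective_rangeRestrict ?_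
    rw [LinearMap.ker_rangeRestrict, LinearMap.exact_iff.1 (R.exact_succ i)]
    exact ih (by rw [← h]; congr 1; omega)

lemma hasProjectiveDimensionLT_of_rank_eq_zero (R : MinimalGradedFreeResolution I) {j : ℕ}
    (h : R.rank (j + 1) = 0) :
    HasProjectiveDimensionLT (ModuleCat.of (MvPolynomial σ k) (MvPolynomial σ k ⧸ I)) (j + 1) := by
  refine hasProjectiveDimensionLT_succ_of_surjective R.aug_surjective ?_
  rw [LinearMap.exact_iff.1 R.exact_zero]
  exact R.hasProjectiveDimensionLT_range_d (by rwa [zero_add])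

lemma exists_isGreatest_betti (R : MinimalGradedFreeResolution I) {i j : ℕ}
    (h : R.betti i j ≠ 0) : ∃ t, IsGreatest {j | R.betti i j ≠ 0} t := by
  have hfin : {j | R.betti i j ≠ 0}.Finite := by
    refine (Set.finite_range (R.shift i)).subset fun j hj => ?_
    exact (R.betti_ne_zero_iff_exists i j).1 hj
  obtain ⟨t, ht, hmax⟩ := hfin.exists_maximal ⟨j, h⟩
  refine ⟨t, ht, fun j hj => ?_⟩
  rcases le_total j t with h | h
  · exact h
  · exact hmax hj h

end MinimalGradedFreeResolution

end ProjectiveDimension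

/-! ### From simplicial forests to forest families -/

section Forest

namespace PreAbstractSimplicialComplex

variable {σ : Type*}

/-- The complex of nonempty subsets of members of a family of sets. -/
def ofFamily {ι : Type*} (s : Finset ι) (f : ι → Finset σ) : PreAbstractSimplicialComplex σ where
  faces := {A | A.Nonempty ∧ ∃ i ∈ s, A ⊆ f i}
  isRelLowerSet_faces := by
    rintro A ⟨hA, i, hi, hAi⟩
    exact ⟨hA, fun B hBA hB => ⟨hB, i, hi, hBA.trans hAi⟩⟩

lemma mem_ofFamily {ι : Type*} {s : Finset ι} {f : ι → Finset σ} {A : Finset σ} :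
    A ∈ ofFamily s f ↔ A.Nonempty ∧ ∃ i ∈ s, A ⊆ f i := Iff.rfl

lemma nonempty_of_mem_facets {Δ : PreAbstractSimplicialComplex σ} {F : Finset σ}
    (hF : F ∈ Δ.facets) : F.Nonempty :=
  (Δ.isRelLowerSet_faces hF.1).1

lemma eq_of_subset_of_mem_facets {Δ : PreAbstractSimplicialComplex σ} {F G : Finset σ}
    (hF : F ∈ Δ.facets) (hG : G ∈ Δ.facets) (h : F ⊆ G) : F = G :=
  hF.eq_of_le hG.1 h

/-- Facets of `Δ` are nonempty and pairwise incomparable, so every chosen one remains maximal. -/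
lemma facets_ofFamily {Δ : PreAbstractSimplicialComplex σ} {ι : Type*} {s : Finset ι}
    {f : ι → Finset σ} (hf : ∀ i, f i ∈ Δ.facets) : (ofFamily s f).facets = f '' s := by
  ext F
  constructor
  · rintro ⟨⟨hF, i, hi, hFi⟩, hmax⟩
    refine ⟨i, hi, ?_⟩
    exact (hmax (mem_ofFamily.2 ⟨nonempty_of_mem_facets (hf i), i, hi, subset_rfl⟩) hFi).antisymm
      hFi
  · rintro ⟨i, hi, rfl⟩
    refine ⟨mem_ofFamily.2 ⟨nonempty_of_mem_facets (hf i), i, hi, subset_rfl⟩, ?_⟩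
    rintro G ⟨-, j, -, hGj⟩ hiG
    rw [eq_of_subset_of_mem_facets (hf i) (hf j) (hiG.trans hGj)]
    exact hGj

lemma IsForest.isForestFamily [DecidableEq σ] {Δ : PreAbstractSimplicialComplex σ}
    (hΔ : Δ.IsForest) {ι : Type*} {f : ι → Finset σ} (hf : ∀ i, f i ∈ Δ.facets)
    (hinj : Function.Injective f) (s : Finset ι) : IsForestFamily s f := by
  intro t _ ht
  have hfac := facets_ofFamily (s := t) hf
  obtain ⟨F, hF, hleaf⟩ := hΔ (ofFamily t f)
    (by rw [IsSubcollection, hfac]; rintro _ ⟨i, -, rfl⟩; exact hf i)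
    (by rw [hfac]; exact Set.Nonempty.image f ht)
  rw [hfac] at hF hleaf
  obtain ⟨a, ha, rfl⟩ := hF
  refine ⟨a, ha, hleaf.imp ?_ ?_⟩
  · intro h
    refine eq_singleton_iff_unique_mem.2 ⟨ha, fun i hi => hinj ?_⟩
    have : f i ∈ f '' t := ⟨i, hi, rfl⟩
    rwa [h] at this
  · rintro ⟨_, ⟨b, hb, rfl⟩, hba, hjoint⟩
    refine ⟨b, hb, fun h => hba (h ▸ rfl), fun l hl hla => ?_⟩
    exact hjoint _ ⟨l, hl, rfl⟩ fun h => hla (hinj h)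

end PreAbstractSimplicialComplex

end Forest

/-! ### Subadditivity for forests -/

theorem mainTheorem1 {k : Type*} [Field k] {n : ℕ}
    (Δ : PreAbstractSimplicialComplex (Fin n)) (hΔ : Δ.IsForest)
    (R : MinimalGradedFreeResolution (Δ.facetIdeal k))
    (a b : ℕ) (ha : 0 < a) (hb : 0 < b)
    (hab : ((a + b : ℕ) : WithBot ℕ∞) ≤ CategoryTheory.projectiveDimension
      (ModuleCat.of (MvPolynomial (Fin n) k) (MvPolynomial (Fin n) k ⧸ Δ.facetIdeal k))) :
    ∃ t_a t_b t_ab : ℕ,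
      IsGreatest {j | R.betti a j ≠ 0} t_a ∧
      IsGreatest {j | R.betti b j ≠ 0} t_b ∧
      IsGreatest {j | R.betti (a + b) j ≠ 0} t_ab ∧
      t_ab ≤ t_a + t_b := by
  -- Numbering the facets supplies the linear order needed for signs.
  obtain ⟨q, ⟨g⟩⟩ := Finite.exists_equiv_fin Δ.facets
  let f : Fin q → Finset (Fin n) := fun i => (g.symm i).1
  have hf : ∀ i, f i ∈ Δ.facets := fun i => (g.symm i).2
  have hinj : Function.Injective f := Subtype.val_injective.comp g.symm.injective
  have hI : Δ.facetIdeal k = squarefreeIdeal k f := by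
    rw [PreAbstractSimplicialComplex.facetIdeal, squarefreeIdeal]
    congr 1
    ext p
    constructor
    · rintro ⟨F, hF, rfl⟩
      exact ⟨g ⟨F, hF⟩, by simp [f]⟩
    · rintro ⟨i, rfl⟩
      exact ⟨f i, hf i, rfl⟩
  have hbetti : ∀ i j, R.betti i j ≠ 0 ↔
      ∃ m : Finset (Fin n), #m = j ∧ TaylorHomologyNonzero k univ f i m := by
    -- The type of `R` depends on the ideal, so the ideal is generalized before being replaced by
    -- `squarefreeIdeal k f`.
    clear hab
    generalize Δ.facetIdeal k = J at R hI
    subst hI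
    exact R.betti_ne_zero_iff_taylorHomologyNonzero
  obtain ⟨c, hc⟩ : ∃ c, a + b = c + 1 := ⟨a + b - 1, by omega⟩
  -- If the free module in degree `a + b` were zero, the projective dimension would be smaller than
  -- `a + b`.
  have hrank : R.rank (a + b) ≠ 0 := by
    rw [CategoryTheory.projectiveDimension_ge_iff] at hab
    intro h
    rw [hc] at h hab
    exact hab (R.hasProjectiveDimensionLT_of_rank_eq_zero h)
  have hforest := hΔ.isForestFamily hf hinj univ
  have hab0 : R.betti (a + b) (R.shift (a + b) ⟨0, Nat.pos_of_ne_zero hrank⟩) ≠ 0 :=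
    (R.betti_ne_zero_iff_exists _ _).2 ⟨_, rfl⟩
  obtain ⟨t_ab, ht_ab⟩ := R.exists_isGreatest_betti hab0
  obtain ⟨m, hm, hmab⟩ := (hbetti _ _).1 ht_ab.1
  obtain ⟨m₁, m₂, h₁, h₂, h₃⟩ := hforest.exists_taylorHomologyNonzero hmab
  have hb₁ : R.betti a #m₁ ≠ 0 := (hbetti _ _).2 ⟨m₁, rfl, h₁⟩
  have hb₂ : R.betti b #m₂ ≠ 0 := (hbetti _ _).2 ⟨m₂, rfl, h₂⟩
  obtain ⟨t_a, ht_a⟩ := R.exists_isGreatest_betti hb₁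
  obtain ⟨t_b, ht_b⟩ := R.exists_isGreatest_betti hb₂
  refine ⟨t_a, t_b, t_ab, ht_a, ht_b, ht_ab, ?_⟩
  calc t_ab = #m := hm.symm
    _ ≤ #(m₁ ∪ m₂) := card_le_card h₃
    _ ≤ #m₁ + #m₂ := card_union_le _ _
    _ ≤ t_a + t_b := add_le_add (ht_a.2 hb₁) (ht_b.2 hb₂)
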